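/- **Theorem 7.1 (Dirichlet–Neumann bracketing).** Let $I=[a,b]$ with $a<b$, let $a=a_0<a_1<\dots<a_n=b$ be a partition of $I$, and set $I_r=[a_r,a_{r+1}]$ for $0\le r\le n-1$. Let $m:I\to\mathbb R$ be nondecreasing, extended to $\mathbb R$ by the constants $m(a)$ on $(-\infty,a)$ and $m(b)$ on $(b,\infty)$; let $m_x=m(x+)-m(x-)$ be its jump at $x$, and let $dm$ be its Lebesgue–Stieltjes measure, $dm((c,d])=m(d+)-m(c+)$. Suppose that (i) $m_{a_r}=0$ for all $r=0,\dots,n$; (ii) $dm([a_r,a_r+\varepsilon])>0$ for all $r=0,\dots,n-1$ and all $\varepsilon>0$; (iii) $dm([a_r-\varepsilon,a_r])>0$ for all $r=1,\dots,n$ and all $\varepsilon>0$. For $J=[u,v]$ equal to $I$ or to one of the $I_r$, let $-\mathcal L^J_D$ and $-\mathcal L^J_N$ be the operators $-D_mD_x$ on the real Hilbert space $L^2((u,v),dm)$ with Dirichlet and with Neumann boundary conditions, defined as follows, with equality of functions meaning equality $dm$-almost everywhere on $(u,v)$ and all integrals in $dm$ taken with respect to the restriction of $dm$ to $(u,v)$.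 For $f,g\in L^2((u,v),dm)$: * $f\in\mathcal D(-\mathcal L_D^J)$ and $-\mathcal L_D^Jf=g$ if and only if $f(x)=\beta(x-u)-\int_u^x dy\int_{[u,y)}dm(z)\,g(z)$, where $\beta=\frac1{v-u}\int_u^v dy\int_{[u,y)}dm(z)\,g(z)$; * $f\in\mathcal D(-\mathcal L_N^J)$ and $-\mathcal L_N^Jf=g$ if and only if $\int_{[u,v)}dm(z)\,g(z)=0$ and, for some constant $c\in\mathbb R$, $f(x)=c-\int_u^x dy\int_{[u,y)}dm(z)\,g(z)$. Let $\mathcal N^J_{m,D}(x)$ and $\mathcal N^J_{m,N}(x)$ be the numbers of eigenvalues $\lambda\in\mathbb R$, $\lambda\le x$, of $-\mathcal L^J_D$ and of $-\mathcal L^J_N$ (distinct eigenvalues are counted, each once). Then for all $x\ge0$ the number $\mathcal N^I_{m,N}(x)$ is finite, and $$\mathcal N^I_{m,D}(x)\le\mathcal N^I_{m,N}(x)\le\mathcal N^I_{m,D}(x)+2,$$ $$\mathcal N^I_{m,D}(x)\ge\sum_{i=0}^{n-1}\mathcal N^{I_i}_{m,D}(x),\qquad \mathcal N^I_{m,N}(x)\le\sum_{i=0}^{n-1}\mathcal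 N^{I_i}_{m,N}(x).$$ Consequently $$\mathcal N^I_{m,D}(x)\le 2n+\sum_{i=0}^{n-1}\mathcal N^{I_i}_{m,D}(x).$$ -/

import Mathlib

open MeasureTheory

/-- The jump `m(x+) - m(x-)` at `x` of a (nondecreasing) function on the line. -/
noncomputable def jumpAt (M : ℝ → ℝ) (x : ℝ) : ℝ :=
  Function.rightLim M x - Function.leftLim M x

/-- The Lebesgue–Stieltjes measure `dm` on `ℝ` of a nondecreasing function `m` on `[a, b]`.
The function is extended by the constants `m a` on the left of `a` and `m b` on the right of `b`,
and replaced by its right-continuous version, so that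
`dm (c, d] = m(d+) - m(c+)` for all `c < d`. -/
noncomputable def stieltjesMeasureOn {a b : ℝ} (hab : a ≤ b) (m : Set.Icc a b → ℝ)
    (hm : Monotone m) : Measure ℝ :=
  (hm.IccExtend hab).stieltjesFunction.measure

/-- The real Hilbert space `L²((u, v), dm)`. -/
abbrev L2On (dm : Measure ℝ) (u v : ℝ) : Type :=
  Lp ℝ 2 (dm.restrict (Set.Ioo u v))

/-- The iterated integral `∫_u^x dy ∫_{[u,y)} dm(z) g(z)` for `g ∈ L²((u, v), dm)`. The inner
integral is against the restriction of `dm` to `(u, v)`. -/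
noncomputable def iteratedIntegral (dm : Measure ℝ) (u v : ℝ) (g : L2On dm u v) (x : ℝ) : ℝ :=
  ∫ y in u..x, ∫ z in Set.Ico u y, g z ∂(dm.restrict (Set.Ioo u v))

/-- The graph of the operator `-D_m D_x` on `L²((u, v), dm)` with Dirichlet boundary conditions:
`f` lies in the domain and is mapped to `g`. -/
def DirichletGraph (dm : Measure ℝ) (u v : ℝ) (f g : L2On dm u v) : Prop :=
  ∀ᵐ x ∂(dm.restrict (Set.Ioo u v)),
    f x = (v - u)⁻¹ * iteratedIntegral dm u v g v * (x - u) - iteratedIntegral dm u v g x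

/-- The graph of the operator `-D_m D_x` on `L²((u, v), dm)` with Neumann boundary conditions:
`f` lies in the domain and is mapped to `g`. -/
def NeumannGraph (dm : Measure ℝ) (u v : ℝ) (f g : L2On dm u v) : Prop :=
  (∫ z in Set.Ico u v, g z ∂(dm.restrict (Set.Ioo u v)) = 0) ∧
  ∃ c : ℝ, ∀ᵐ x ∂(dm.restrict (Set.Ioo u v)), f x = c - iteratedIntegral dm u v g x

/-- `ev` is an eigenvalue of the Dirichlet operator. -/
def IsDirichletEigenvalue (dm : Measure ℝ) (u v ev : ℝ) : Prop :=
  ∃ f : L2On dm u v, f ≠ 0 ∧ DirichletGraph dm u v f (ev • f)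

/-- `ev` is an eigenvalue of the Neumann operator. -/
def IsNeumannEigenvalue (dm : Measure ℝ) (u v ev : ℝ) : Prop :=
  ∃ f : L2On dm u v, f ≠ 0 ∧ NeumannGraph dm u v f (ev • f)

/-- The Dirichlet counting function: the number of real eigenvalues that are at most `x`
(a priori possibly infinite). -/
noncomputable def dirichletCount (dm : Measure ℝ) (u v x : ℝ) : ℕ∞ :=
  {ev : ℝ | ev ≤ x ∧ IsDirichletEigenvalue dm u v ev}.encard

/-- The Neumann counting function: the number of real eigenvalues that are at most `x`
(a priori possibly infinite). -/
noncomputable def neumannCount (dm : Measure ℝ) (u v x : ℝ) : ℕ∞ :=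
  {ev : ℝ | ev ≤ x ∧ IsNeumannEigenvalue dm u v ev}.encard

/-! Both eigenvalue problems on $[u,v]$ come from one pair of quadratic forms, the mass $\int
F^2\,dm$ and the energy $\int F'^2\,dx$. They differ only in the form domain: `neumannForms`
contains all primitives, and `dirichletForms` those vanishing at both endpoints. Pairs $(F,F')$ live
in one space for all intervals, so the forms of $I$ and of its pieces apply to the same vector.

All count comparisons rest on one dimension argument. If one problem has more eigenfunctions with
eigenvalue at most $x$ than there are linear constraints, some combination $z$ of positive mass
satisfies the constraints and has energy at most $x$ times its mass
(`exists_mem_span_forall_eq_zero`). If the constraints are orthogonality to the eigenfunctions of a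
second problem whose form domain contains $z$, then completeness (`IsEigensystem.complete`) makes
the energy strictly larger than that, a contradiction. The relations between form domains then give
the theorem: Dirichlet lies inside Neumann and is cut out by two evaluations; extension by zero
sends Dirichlet functions of a piece to Dirichlet functions of $I$; Neumann functions on $I$
restrict to Neumann functions on each piece.

Completeness comes from the spectral theorem for $A^\dagger A$, where $A$ is the compact operator
`primitiveOp`, $h\mapsto\int_u^x h$, from $L^2(dx)$ to $L^2(dm)$, combined with a projection: onto
mean-zero derivatives (Dirichlet) or onto mean-zero functions (Neumann). A nonzero eigenvalue
$\kappa$ of $A^\dagger A$ corresponds to $1/\kappa$ for $-D_mD_x$. Uniqueness for a Volterra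
equation makes eigenvalues simple, so one eigenfunction per distinct eigenvalue suffices. -/

/-! ### Hilbert space and linear algebra: Rayleigh quotients, compactness, dimension count. -/

section Abstract

open Module.End InnerProductSpace

variable {E H : Type*} [NormedAddCommGroup E] [InnerProductSpace ℝ E]
  [NormedAddCommGroup H] [InnerProductSpace ℝ H]

/-- If `k` is orthogonal to the eigenvectors of a compact symmetric operator `T` for the
eigenvalues `κ` with `1 ≤ κ * x`, then the Rayleigh quotient of `k` is below `1 / x`. -/
theorem mul_inner_lt_norm_sq_of_orthogonal [CompleteSpace E] {T : E →L[ℝ] E}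
    (hT : IsCompactOperator T) (hsymm : T.IsSymmetric) {x : ℝ} {k : E}
    (hk : ∀ (κ : ℝ) (h : E), T h = κ • h → 1 ≤ κ * x → ⟪h, k⟫_ℝ = 0) (hk0 : k ≠ 0) :
    x * ⟪T k, k⟫_ℝ < ‖k‖ ^ 2 := by
  -- Spectral theorem: `k` is the orthogonal sum of its components `w μ` in the eigenspaces, which
  -- reduces the claim to a termwise comparison of two series.
  have hsum : IsHilbertSum ℝ (fun μ : ℝ => eigenspace (T : Module.End ℝ E) μ)
      fun μ => (eigenspace (T : Module.End ℝ E) μ).subtypeₗᵢ := by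
    have hcl (μ : ℝ) : CompleteSpace (eigenspace (T : Module.End ℝ E) μ) := by
      have : IsClosed ((eigenspace (T : Module.End ℝ E) μ : Submodule ℝ E) : Set E) := by
        have h1 : ((eigenspace (T : Module.End ℝ E) μ : Submodule ℝ E) : Set E) =
            {v | T v = μ • v} := by
          ext v; simp
        rw [h1]
        exact isClosed_eq T.continuous (continuous_const_smul μ)
      exact this.completeSpace_coe
    refine IsHilbertSum.mkInternal _ hsymm.orthogonalFamily_eigenspaces ?_
    rw [Submodule.topologicalClosure_eq_top_iff.mpr]
    exact T.orthogonalComplement_iSup_eigenspaces_eq_bot hT hsymm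
  set w := hsum.linearIsometryEquiv k with hw
  have hks : HasSum (fun μ => (w μ : E)) k := by
    have := hsum.hasSum_linearIsometryEquiv_symm w
    simpa [hw] using this
  have hTw (μ : ℝ) : T (w μ) = μ • (w μ : E) := by
    simpa using mem_eigenspace_iff.mp (w μ).2
  have hself (μ : ℝ) : ⟪(w μ : E), k⟫_ℝ = ‖(w μ : E)‖ ^ 2 := by
    have h1 : HasSum (fun ν => ⟪(w μ : E), (w ν : E)⟫_ℝ) ⟪(w μ : E), k⟫_ℝ :=
      hks.mapL (innerSL ℝ (w μ : E))
    have h2 : HasSum (fun ν => ⟪(w μ : E), (w ν : E)⟫_ℝ) ⟪(w μ : E), (w μ : E)⟫_ℝ := by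
      refine hasSum_single μ fun ν hν => ?_
      exact hsymm.orthogonalFamily_eigenspaces hν.symm (w μ) (w ν)
    rw [h1.unique h2, real_inner_self_eq_norm_sq]
  have hn : HasSum (fun μ => ⟪(w μ : E), k⟫_ℝ) (‖k‖ ^ 2) := by
    have h1 := hks.mapL (innerSL ℝ k)
    rw [← real_inner_self_eq_norm_sq]
    simpa [real_inner_comm] using h1
  have hTs : HasSum (fun μ => x * (μ * ⟪(w μ : E), k⟫_ℝ)) (x * ⟪T k, k⟫_ℝ) := by
    have h1 := (hks.mapL T).mapL (innerSL ℝ k)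
    refine HasSum.mul_left x ?_
    simpa [hTw, inner_smul_right, real_inner_comm] using h1
  -- `w μ` is itself an eigenvector for `μ`, so `hk` removes every term with `1 ≤ μ * x`.
  have hlt (μ : ℝ) (hμ : ⟪(w μ : E), k⟫_ℝ ≠ 0) :
      x * (μ * ⟪(w μ : E), k⟫_ℝ) < ⟪(w μ : E), k⟫_ℝ := by
    have h1 : μ * x < 1 := by
      by_contra! h
      exact hμ (hk μ _ (hTw μ) h)
    have h2 : 0 < ⟪(w μ : E), k⟫_ℝ := lt_of_le_of_ne (by rw [hself]; positivity) hμ.symm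
    nlinarith
  obtain ⟨μ, hμ⟩ : ∃ μ, ⟪(w μ : E), k⟫_ℝ ≠ 0 := by
    by_contra! h
    simp only [h] at hn
    exact hk0 (by simpa using hn.unique hasSum_zero)
  refine hasSum_lt (fun ν => ?_) (hlt μ hμ) hTs hn
  by_cases hν : ⟪(w ν : E), k⟫_ℝ = 0
  · simp [hν]
  · exact (hlt ν hν).le

/-- If `k` is orthogonal to the eigenvectors of `A† A`, `A` compact, for the eigenvalues `κ` with
`1 ≤ κ * x`, then `x * ‖A k‖ ^ 2 < ‖k‖ ^ 2`. -/
theorem mul_norm_sq_lt_of_orthogonal [CompleteSpace E] [CompleteSpace H] {A : E →L[ℝ] H}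
    (hA : IsCompactOperator A) {x : ℝ} {k : E}
    (hk : ∀ (κ : ℝ) (h : E), A.adjoint (A h) = κ • h → 1 ≤ κ * x → ⟪h, k⟫_ℝ = 0) (hk0 : k ≠ 0) :
    x * ‖A k‖ ^ 2 < ‖k‖ ^ 2 := by
  have h1 : IsCompactOperator (A.adjoint ∘L A) := hA.clm_comp A.adjoint
  have h2 : (A.adjoint ∘L A).IsSymmetric := by
    intro y z
    simp [ContinuousLinearMap.adjoint_inner_left, ContinuousLinearMap.adjoint_inner_right]
  have := mul_inner_lt_norm_sq_of_orthogonal h1 h2 (x := x) hk hk0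
  simpa [ContinuousLinearMap.adjoint_inner_left, real_inner_self_eq_norm_sq] using this

/-- An operator that is arbitrarily small off finite-dimensional subspaces is compact. -/
theorem isCompactOperator_of_forall_exists_finiteDimensional [CompleteSpace H] {A : E →L[ℝ] H}
    (h : ∀ ε > 0, ∃ U : Submodule ℝ E, FiniteDimensional ℝ U ∧ ∀ v ∈ Uᗮ, ‖A v‖ ≤ ε * ‖v‖) :
    IsCompactOperator A := by
  have hcl : A ∈ closure {B : E →L[ℝ] H | IsCompactOperator B} := by
    refine Metric.mem_closure_iff.mpr fun ε hε => ?_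
    obtain ⟨U, hU, hAU⟩ := h (ε / 2) (half_pos hε)
    -- A finite-rank approximant; the error is `A` restricted to `Uᗮ`.
    refine ⟨A ∘L U.starProjection, ?_, ?_⟩
    · have h0 : IsCompactOperator (U.orthogonalProjectionOnto : E → U) := by
        have hid : IsCompactOperator (id : U → U) :=
          isCompactOperator_id_iff_finiteDimensional.mpr hU
        exact hid.comp_clm U.orthogonalProjectionOnto
      exact h0.clm_comp (A ∘L U.subtypeL)
    · rw [dist_eq_norm]
      refine lt_of_le_of_lt (ContinuousLinearMap.opNorm_le_bound _ (half_pos hε).le fun v => ?_)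
        (half_lt_self hε)
      have h1 : (A - A ∘L U.starProjection) v = A (v - U.starProjection v) := by simp
      rw [h1]
      refine (hAU _ (U.sub_starProjection_mem_orthogonal v)).trans ?_
      gcongr
      have := Uᗮ.norm_starProjection_apply_le v
      rwa [Submodule.starProjection_orthogonal_val] at this
  exact isClosed_setOfPred_isCompactOperator.closure_subset hcl

/-- Among more vectors than linear constraints, orthonormal for `B` and diagonal for `Q` with
entries at most `x`, some combination satisfies all constraints and has quotient at most `x`. -/
theorem exists_mem_span_forall_eq_zero {X ι κ : Type*} [AddCommGroup X] [Module ℝ X] [Fintype ι]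
    [Fintype κ] [DecidableEq ι] (B Q : LinearMap.BilinForm ℝ X) (w : ι → X) (ev : ι → ℝ) {x : ℝ}
    (hev : ∀ i, ev i ≤ x) (hB : ∀ i j, B (w i) (w j) = if i = j then 1 else 0)
    (hQ : ∀ i j, Q (w i) (w j) = if i = j then ev i else 0)
    (ℓ : κ → X →ₗ[ℝ] ℝ) (hcard : Fintype.card κ < Fintype.card ι) :
    ∃ z ∈ Submodule.span ℝ (Set.range w), (∀ k, ℓ k z = 0) ∧ 0 < B z z ∧ Q z z ≤ x * B z z := by
  let f : (ι → ℝ) →ₗ[ℝ] (κ → ℝ) := LinearMap.pi fun k => ℓ k ∘ₗ Fintype.linearCombination ℝ w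
  -- There are more coefficients than equations.
  have hker : LinearMap.ker f ≠ ⊥ := f.ker_ne_bot_of_finrank_lt (by simpa using hcard)
  obtain ⟨c, hc, hc0⟩ := Submodule.exists_mem_ne_zero_of_ne_bot hker
  have hexp (F : LinearMap.BilinForm ℝ X) (d : ι → ℝ)
      (hF : ∀ i j, F (w i) (w j) = if i = j then d i else 0) :
      F (∑ i, c i • w i) (∑ i, c i • w i) = ∑ i, d i * c i ^ 2 := by
    simp only [map_sum, map_smul, LinearMap.sum_apply, LinearMap.smul_apply, hF, smul_eq_mul]
    refine Finset.sum_congr rfl fun i _ => ?_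
    simp
    ring
  have hBz := hexp B (fun _ => 1) hB
  have hQz := hexp Q ev hQ
  refine ⟨∑ i, c i • w i, ?_, fun k => ?_, ?_, ?_⟩
  · exact Submodule.sum_mem _ fun i _ =>
      Submodule.smul_mem _ _ (Submodule.subset_span (Set.mem_range_self i))
  · simpa [f, Fintype.linearCombination_apply] using congrFun hc k
  · rw [hBz]
    obtain ⟨i, hi⟩ := Function.ne_iff.mp hc0
    refine Finset.sum_pos' (fun j _ => by positivity) ⟨i, Finset.mem_univ i, ?_⟩
    have : c i ≠ 0 := hi
    positivity
  · rw [hBz, hQz, Finset.mul_sum]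
    refine Finset.sum_le_sum fun i _ => ?_
    nlinarith [hev i, sq_nonneg (c i)]

end Abstract

/-! ### Integral inequalities and Fubini for the cumulative function. -/

section Preliminaries

open Set

/-- Cauchy–Schwarz against the constant function `1`. -/
theorem sq_integral_le_measureReal_mul {α : Type*} [MeasurableSpace α] {ν : Measure α}
    [IsFiniteMeasure ν] {h : α → ℝ} (hh : MemLp h 2 ν) :
    (∫ x, h x ∂ν) ^ 2 ≤ ν.real univ * ∫ x, h x ^ 2 ∂ν := by
  have hint : Integrable h ν := hh.integrable (by norm_num)
  have key (c : ℝ) : 0 ≤ (∫ x, h x ^ 2 ∂ν) - 2 * c * (∫ x, h x ∂ν) + c ^ 2 * ν.real univ := by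
    have h1 : 0 ≤ ∫ x, (h x - c) ^ 2 ∂ν := integral_nonneg fun x => sq_nonneg _
    have h2 : ∫ x, (h x - c) ^ 2 ∂ν =
        (∫ x, h x ^ 2 ∂ν) - 2 * c * (∫ x, h x ∂ν) + c ^ 2 * ν.real univ := by
      have h3 : ∀ x, (h x - c) ^ 2 = (h x ^ 2 - 2 * c * h x) + c ^ 2 := fun x => by ring
      simp_rw [h3]
      have h4 : Integrable (fun x => h x ^ 2 - 2 * c * h x) ν :=
        hh.integrable_sq.sub (hint.const_mul _)
      rw [integral_add h4 (integrable_const _), integral_sub hh.integrable_sq (hint.const_mul _), integral_const_mul, integral_const]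
      simp [mul_comm]
    linarith
  rcases eq_or_lt_of_le (measureReal_nonneg (μ := ν) (s := univ)) with h0 | hpos
  · have : ν = 0 := by
      rw [← Measure.measure_univ_eq_zero, ← measureReal_eq_zero_iff]
      exact h0.symm
    simp [this]
  -- The mean of `h` minimizes the quadratic polynomial in `c`.
  · have h1 := key ((∫ x, h x ∂ν) / ν.real univ)
    have h2 : (∫ x, h x ^ 2 ∂ν) - 2 * ((∫ x, h x ∂ν) / ν.real univ) * (∫ x, h x ∂ν) +
        ((∫ x, h x ∂ν) / ν.real univ) ^ 2 * ν.real univ =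
        (∫ x, h x ^ 2 ∂ν) - (∫ x, h x ∂ν) ^ 2 / ν.real univ := by
      field_simp
      ring
    rw [h2, sub_nonneg, div_le_iff₀ hpos] at h1
    linarith

theorem sq_intervalIntegral_le {h : ℝ → ℝ} {u v s t : ℝ}
    (hh : MemLp h 2 (volume.restrict (Ioc u v))) (hus : u ≤ s) (hst : s ≤ t) (htv : t ≤ v) :
    (∫ y in s..t, h y) ^ 2 ≤ (t - s) * ∫ y in Ioc u v, h y ^ 2 := by
  have hsub : Ioc s t ⊆ Ioc u v := Ioc_subset_Ioc hus htv
  rw [intervalIntegral.integral_of_le hst]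
  refine (sq_integral_le_measureReal_mul
    (hh.mono_measure (Measure.restrict_mono hsub le_rfl))).trans ?_
  have h1 : (volume.restrict (Ioc s t)).real univ = t - s := by
    simp [measureReal_def, hst]
  rw [h1]
  refine mul_le_mul_of_nonneg_left ?_ (by linarith)
  exact setIntegral_mono_set hh.integrable_sq (ae_of_all _ fun y => sq_nonneg _) hsub.eventuallyLE

/-- A function whose primitive vanishes on a grid of mesh `(v - u) / N` has a small primitive. -/
theorem sq_intervalIntegral_le_of_grid {h : ℝ → ℝ} {u v : ℝ} (huv : u < v) {N : ℕ} (hN : 0 < N)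
    (hh : MemLp h 2 (volume.restrict (Ioc u v)))
    (hgrid : ∀ j : Fin (N + 1), ∫ y in u..(u + j * ((v - u) / N)), h y = 0)
    {x : ℝ} (hx : x ∈ Icc u v) :
    (∫ y in u..x, h y) ^ 2 ≤ ((v - u) / N) * ∫ y in Ioc u v, h y ^ 2 := by
  have hN' : (0 : ℝ) < N := by exact_mod_cast hN
  set δ := (v - u) / N with hδ
  have hδ0 : 0 < δ := div_pos (by linarith) hN'
  have hNδ : N * δ = v - u := by rw [hδ]; field_simp
  have hq0 : 0 ≤ (x - u) / δ := div_nonneg (by linarith [hx.1]) hδ0.le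
  -- Index of the last grid point not exceeding `x`: the primitive vanishes there, so only an
  -- interval of length less than `δ` contributes.
  set j := ⌊(x - u) / δ⌋₊ with hj
  have hj1 : (j : ℝ) * δ ≤ x - u := (le_div_iff₀ hδ0).mp (Nat.floor_le hq0)
  have hj2 : x - u < (j + 1) * δ := (div_lt_iff₀ hδ0).mp (Nat.lt_floor_add_one _)
  have hjN : j < N + 1 := by
    have : (j : ℝ) * δ < (N + 1) * δ := by nlinarith [hx.2]
    exact_mod_cast lt_of_mul_lt_mul_right this hδ0.le
  have hint : IntegrableOn h (Ioc u v) := hh.integrable (by norm_num)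
  have hju : u ≤ u + j * δ := by have := mul_nonneg (Nat.cast_nonneg (α := ℝ) j) hδ0.le; linarith
  have hsplit : ∫ y in u..x, h y = ∫ y in (u + j * δ)..x, h y := by
    have h1 := intervalIntegral.integral_add_adjacent_intervals (a := u) (b := u + j * δ) (c := x)
      (f := h) (μ := volume)
      ((intervalIntegrable_iff_integrableOn_Ioc_of_le hju).mpr
        (hint.mono_set (Ioc_subset_Ioc le_rfl (by linarith [hx.2]))))
      ((intervalIntegrable_iff_integrableOn_Ioc_of_le (by linarith)).mpr
        (hint.mono_set (Ioc_subset_Ioc hju hx.2)))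
    rw [← h1, hgrid ⟨j, hjN⟩, zero_add]
  rw [hsplit]
  refine (sq_intervalIntegral_le hh hju (by linarith) hx.2).trans ?_
  exact mul_le_mul_of_nonneg_right (by linarith) (integral_nonneg fun y => sq_nonneg _)

/-- The function `y ↦ ∫_{[u, y)} g dm` on `(u, v)`. -/
noncomputable def cumulative (dm : Measure ℝ) (u v : ℝ) (g : ℝ → ℝ) (y : ℝ) : ℝ :=
  ∫ z in Ico u y, g z ∂(dm.restrict (Ioo u v))

theorem iteratedIntegral_eq (dm : Measure ℝ) (u v : ℝ) (g : L2On dm u v) (x : ℝ) :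
    iteratedIntegral dm u v g x = ∫ y in u..x, cumulative dm u v g y := rfl

variable {dm : Measure ℝ} {u v : ℝ}

instance isFiniteMeasure_restrict_Ioo_of_locallyFinite [IsLocallyFiniteMeasure dm] :
    IsFiniteMeasure (dm.restrict (Ioo u v)) :=
  ⟨by simpa using measure_Ioo_lt_top⟩

theorem cumulative_eq_integral_indicator (g : ℝ → ℝ) (y : ℝ) :
    cumulative dm u v g y = ∫ z, {w : ℝ | w < y}.indicator g z ∂(dm.restrict (Ioo u v)) := by
  rw [cumulative, ← integral_indicator measurableSet_Ico]
  refine integral_congr_ae ?_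
  filter_upwards [ae_restrict_mem measurableSet_Ioo] with z hz
  by_cases h : z < y <;> simp [indicator, h, hz.1.le]

theorem stronglyMeasurable_cumulative [IsLocallyFiniteMeasure dm] {g : ℝ → ℝ} (hg : StronglyMeasurable g) :
    StronglyMeasurable (cumulative dm u v g) := by
  have h1 : StronglyMeasurable fun p : ℝ × ℝ => {w : ℝ | w < p.1}.indicator g p.2 := by
    have : (fun p : ℝ × ℝ => {w : ℝ | w < p.1}.indicator g p.2) =
        {p : ℝ × ℝ | p.2 < p.1}.indicator fun p => g p.2 := by
      ext p; simp [indicator]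
    rw [this]
    exact (hg.comp_measurable measurable_snd).indicator
      (measurableSet_lt measurable_snd measurable_fst)
  have h2 := h1.integral_prod_right' (ν := dm.restrict (Ioo u v))
  convert h2 using 1
  ext y
  exact cumulative_eq_integral_indicator g y

theorem abs_cumulative_le {g : ℝ → ℝ} (hg : Integrable g (dm.restrict (Ioo u v))) (y : ℝ) :
    |cumulative dm u v g y| ≤ ∫ z, |g z| ∂(dm.restrict (Ioo u v)) :=
  (abs_integral_le_integral_abs).trans
    (setIntegral_le_integral hg.abs (ae_of_all _ fun _ => abs_nonneg _))

theorem cumulative_congr {g g' : ℝ → ℝ} (h : g =ᵐ[dm.restrict (Ioo u v)] g') :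
    cumulative dm u v g = cumulative dm u v g' := by
  ext y
  exact integral_congr_ae (ae_restrict_of_ae h)

/-- Integration by parts: `∫_u^v (∫_{[u,y)} g dm) k(y) dy = ∫ g(z) (∫_z^v k) dm(z)`. -/
theorem integral_cumulative_mul [IsLocallyFiniteMeasure dm] {g k : ℝ → ℝ} (hg : Integrable g (dm.restrict (Ioo u v)))
    (hk : IntegrableOn k (Ioc u v)) :
    ∫ y in Ioc u v, cumulative dm u v g y * k y =
      ∫ z, g z * (∫ y in z..v, k y) ∂(dm.restrict (Ioo u v)) := by
  have h1 (y : ℝ) : cumulative dm u v g y * k y =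
      ∫ z, {p : ℝ × ℝ | p.2 < p.1}.indicator (fun p => k p.1 * g p.2) (y, z)
        ∂(dm.restrict (Ioo u v)) := by
    rw [cumulative_eq_integral_indicator, mul_comm, ← integral_const_mul]
    refine integral_congr_ae (ae_of_all _ fun z => ?_)
    by_cases h : z < y <;> simp [indicator, h]
  simp_rw [h1]
  -- Fubini on the triangle `z < y`.
  have hint : Integrable ({p : ℝ × ℝ | p.2 < p.1}.indicator (fun p => k p.1 * g p.2))
      ((volume.restrict (Ioc u v)).prod (dm.restrict (Ioo u v))) :=
    (Integrable.mul_prod hk hg).indicator (measurableSet_lt measurable_snd measurable_fst)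
  rw [integral_integral_swap (f := fun y z =>
    {p : ℝ × ℝ | p.2 < p.1}.indicator (fun p => k p.1 * g p.2) (y, z)) hint]
  refine integral_congr_ae ?_
  filter_upwards [ae_restrict_mem measurableSet_Ioo] with z hz
  have h2 (y : ℝ) : {p : ℝ × ℝ | p.2 < p.1}.indicator (fun p => k p.1 * g p.2) (y, z) =
      g z * (Ioi z).indicator k y := by
    by_cases h : z < y <;> simp [indicator, h, mul_comm]
  simp_rw [h2]
  rw [integral_const_mul, integral_indicator measurableSet_Ioi,
    Measure.restrict_restrict measurableSet_Ioi, intervalIntegral.integral_of_le hz.2.le]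
  congr 3
  ext y
  simp only [mem_inter_iff, mem_Ioi, mem_Ioc]
  constructor
  · rintro ⟨h, -, h'⟩; exact ⟨h, h'⟩
  · rintro ⟨h, h'⟩; exact ⟨h, hz.1.trans h, h'⟩

end Preliminaries

/-! ### The primitive operator, its compactness and its adjoint. -/

section Operators

open Set InnerProductSpace

theorem MeasureTheory.L2.inner_eq_integral_mul {α : Type*} [MeasurableSpace α] {ν : Measure α}
    (f g : Lp ℝ 2 ν) : ⟪f, g⟫_ℝ = ∫ x, f x * g x ∂ν := by
  rw [L2.inner_def]
  simp [mul_comm]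

/-- `L²` of the interval `(u, v]` with Lebesgue measure, containing the derivatives. -/
abbrev DerivSpace (u v : ℝ) : Type := Lp ℝ 2 (volume.restrict (Ioc u v))

variable {dm : Measure ℝ} {u v : ℝ}

theorem DerivSpace.integrableOn (h : DerivSpace u v) : IntegrableOn h (Ioc u v) :=
  (Lp.memLp h).integrable (by norm_num)

theorem DerivSpace.intervalIntegrable (h : DerivSpace u v) {s t : ℝ} (hs : s ∈ Icc u v)
    (ht : t ∈ Icc u v) : IntervalIntegrable h volume s t :=
  intervalIntegrable_iff.mpr (h.integrableOn.mono_set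
    (Ioc_subset_Ioc (le_min hs.1 ht.1) (max_le hs.2 ht.2)))

theorem L2On.integrable [IsLocallyFiniteMeasure dm] (g : L2On dm u v) :
    Integrable g (dm.restrict (Ioo u v)) :=
  (Lp.memLp g).integrable (by norm_num)

theorem DerivSpace.norm_sq (h : DerivSpace u v) : ‖h‖ ^ 2 = ∫ y in Ioc u v, h y ^ 2 := by
  rw [← real_inner_self_eq_norm_sq, L2.inner_eq_integral_mul]
  simp_rw [sq]

theorem DerivSpace.abs_intervalIntegral_le (h : DerivSpace u v) {x : ℝ} (hx : x ∈ Icc u v) :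
    |∫ y in u..x, h y| ≤ √(v - u) * ‖h‖ := by
  refine abs_le_of_sq_le_sq ?_ (by positivity)
  rw [mul_pow, Real.sq_sqrt (by linarith [hx.1, hx.2]), h.norm_sq]
  refine (sq_intervalIntegral_le (Lp.memLp h) le_rfl hx.1 hx.2).trans ?_
  exact mul_le_mul_of_nonneg_right (by linarith [hx.2]) (integral_nonneg fun y => sq_nonneg _)

theorem DerivSpace.aestronglyMeasurable_primitive (h : DerivSpace u v) :
    AEStronglyMeasurable (fun x => ∫ y in u..x, h y) (dm.restrict (Ioo u v)) := by
  have h1 : ContinuousOn (fun x => ∫ y in u..x, h y) (Icc u v) :=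
    intervalIntegral.continuousOn_primitive ((integrableOn_Icc_iff_integrableOn_Ioc (by finiteness)).mpr h.integrableOn) |>.congr fun x hx =>
      intervalIntegral.integral_of_le hx.1
  exact (h1.mono Ioo_subset_Icc_self).aestronglyMeasurable measurableSet_Ioo

theorem cumulative_smul (c : ℝ) (g : L2On dm u v) (y : ℝ) :
    cumulative dm u v (c • g : L2On dm u v) y = c * cumulative dm u v g y := by
  rw [cumulative_congr (Lp.coeFn_smul c g), cumulative, cumulative, ← integral_const_mul]
  rfl

theorem iteratedIntegral_smul (c : ℝ) (g : L2On dm u v) (x : ℝ) :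
    iteratedIntegral dm u v (c • g) x = c * iteratedIntegral dm u v g x := by
  rw [iteratedIntegral_eq, iteratedIntegral_eq, ← intervalIntegral.integral_const_mul]
  simp_rw [cumulative_smul]

variable [IsLocallyFiniteMeasure dm]

theorem DerivSpace.memLp_primitive (h : DerivSpace u v) :
    MemLp (fun x => ∫ y in u..x, h y) 2 (dm.restrict (Ioo u v)) := by
  refine MemLp.of_bound h.aestronglyMeasurable_primitive (√(v - u) * ‖h‖) ?_
  filter_upwards [ae_restrict_mem measurableSet_Ioo] with x hx
  exact h.abs_intervalIntegral_le (Ioo_subset_Icc_self hx)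

variable (dm u v) in
/-- The operator `h ↦ (x ↦ ∫_u^x h)` from `L²((u, v], dx)` to `L²((u, v), dm)`. -/
noncomputable def primitiveOp : DerivSpace u v →L[ℝ] L2On dm u v :=
  LinearMap.mkContinuous
    { toFun h := h.memLp_primitive.toLp _
      map_add' h k := by
        rw [← MemLp.toLp_add]
        refine MemLp.toLp_congr _ _ ?_
        filter_upwards [ae_restrict_mem measurableSet_Ioo] with x hx
        have hx' := Ioo_subset_Icc_self hx
        have hu : u ∈ Icc u v := ⟨le_rfl, hx'.1.trans hx'.2⟩
        rw [Pi.add_apply, ← intervalIntegral.integral_add (h.intervalIntegrable hu hx')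
          (k.intervalIntegrable hu hx'), intervalIntegral.integral_of_le hx'.1,
          intervalIntegral.integral_of_le hx'.1]
        refine integral_congr_ae ?_
        exact ae_restrict_of_ae_restrict_of_subset (Ioc_subset_Ioc le_rfl hx'.2)
          (Lp.coeFn_add h k)
      map_smul' c h := by
        rw [RingHom.id_apply, ← MemLp.toLp_const_smul]
        refine MemLp.toLp_congr _ _ ?_
        filter_upwards [ae_restrict_mem measurableSet_Ioo] with x hx
        have hx' := Ioo_subset_Icc_self hx
        rw [Pi.smul_apply, ← intervalIntegral.integral_smul,
          intervalIntegral.integral_of_le hx'.1, intervalIntegral.integral_of_le hx'.1]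
        refine integral_congr_ae ?_
        exact ae_restrict_of_ae_restrict_of_subset (Ioc_subset_Ioc le_rfl hx'.2)
          (Lp.coeFn_smul c h) }
    ((dm.restrict (Ioo u v)).real univ ^ ((2 : ENNReal).toReal)⁻¹ * √(v - u)) fun h => by
      rw [mul_assoc]
      refine Lp.norm_le_of_ae_bound (by positivity) ?_
      filter_upwards [MemLp.coeFn_toLp (h.memLp_primitive (dm := dm)),
        ae_restrict_mem measurableSet_Ioo] with x hx1 hx
      exact (congrArg norm hx1).trans_le (h.abs_intervalIntegral_le (Ioo_subset_Icc_self hx))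

theorem coeFn_primitiveOp (h : DerivSpace u v) :
    primitiveOp dm u v h =ᵐ[dm.restrict (Ioo u v)] fun x => ∫ y in u..x, h y :=
  MemLp.coeFn_toLp h.memLp_primitive

/-- If `h` is orthogonal to the indicators of the intervals from `u` to the points of a grid of mesh
`δ`, its primitive vanishes on the grid and is at most `√δ * ‖h‖` everywhere. Finitely many
constraints thus make the operator arbitrarily small. -/
theorem isCompactOperator_primitiveOp (huv : u < v) :
    IsCompactOperator (primitiveOp dm u v) := by
  refine isCompactOperator_of_forall_exists_finiteDimensional fun ε hε => ?_
  set C := (dm.restrict (Ioo u v)).real univ ^ ((2 : ENNReal).toReal)⁻¹ with hC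
  have hC0 : 0 ≤ C := by positivity
  -- `C` converts a uniform bound into a bound of the norm in $L^2(dm)$; `N` is chosen so that `C *
  -- √((v - u) / N) ≤ ε`.
  obtain ⟨N, hN⟩ := exists_nat_gt ((v - u) * C ^ 2 / ε ^ 2)
  have hN0 : (0 : ℝ) < N := lt_of_le_of_lt (by have := sub_pos.mpr huv; positivity) hN
  have hsmall : C * √((v - u) / N) ≤ ε := by
    refine abs_le_of_sq_le_sq' ?_ hε.le |>.2
    rw [mul_pow, Real.sq_sqrt (div_nonneg (sub_pos.mpr huv).le hN0.le)]
    rw [div_lt_iff₀ (by positivity)] at hN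
    rw [mul_div_assoc', div_le_iff₀ hN0]
    linarith
  let b (j : Fin (N + 1)) : DerivSpace u v :=
    indicatorConstLp 2 (μ := volume.restrict (Ioc u v))
      (measurableSet_Ioc (a := u) (b := u + j * ((v - u) / N))) (measure_ne_top _ _) (1 : ℝ)
  refine ⟨Submodule.span ℝ (range b), .span_of_finite ℝ (finite_range b), fun h hh => ?_⟩
  have hgrid (j : Fin (N + 1)) : ∫ y in u..(u + j * ((v - u) / N)), h y = 0 := by
    have h1 : ⟪b j, h⟫_ℝ = 0 := Submodule.inner_right_of_mem_orthogonal
      (Submodule.subset_span (mem_range_self j)) hh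
    have hδ : 0 ≤ (v - u) / N := div_nonneg (sub_pos.mpr huv).le hN0.le
    have hj : (j : ℝ) * ((v - u) / N) ≤ v - u := by
      have h2 : (j : ℝ) ≤ N := by exact_mod_cast Nat.lt_succ_iff.mp j.2
      calc (j : ℝ) * ((v - u) / N) ≤ N * ((v - u) / N) := mul_le_mul_of_nonneg_right h2 hδ
        _ = v - u := by field_simp
    rw [L2.inner_indicatorConstLp_one, Measure.restrict_restrict measurableSet_Ioc,
      inter_eq_left.mpr (Ioc_subset_Ioc le_rfl (by linarith))] at h1
    rw [intervalIntegral.integral_of_le (by have : (0:ℝ) ≤ j := Nat.cast_nonneg _; nlinarith), h1]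
  have hbound : ‖primitiveOp dm u v h‖ ≤ C * (√((v - u) / N) * ‖h‖) := by
    refine Lp.norm_le_of_ae_bound (by positivity) ?_
    filter_upwards [coeFn_primitiveOp (dm := dm) h, ae_restrict_mem measurableSet_Ioo] with x hx1 hx
    rw [hx1]
    refine abs_le_of_sq_le_sq ?_ (by positivity)
    rw [mul_pow, Real.sq_sqrt (div_nonneg (sub_pos.mpr huv).le hN0.le), h.norm_sq]
    exact sq_intervalIntegral_le_of_grid huv (by exact_mod_cast hN0) (Lp.memLp h) hgrid
      (Ioo_subset_Icc_self hx)
  refine hbound.trans ?_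
  rw [← mul_assoc]
  exact mul_le_mul_of_nonneg_right hsmall (norm_nonneg _)

theorem memLp_cumulative (g : L2On dm u v) (p : ENNReal) :
    MemLp (cumulative dm u v g) p (volume.restrict (Ioc u v)) :=
  MemLp.of_bound (stronglyMeasurable_cumulative (Lp.stronglyMeasurable g)).aestronglyMeasurable
    (∫ z, |g z| ∂(dm.restrict (Ioo u v))) (ae_of_all _ (abs_cumulative_le g.integrable))

theorem intervalIntegrable_cumulative (g : L2On dm u v) {x : ℝ} (hx : x ∈ Icc u v) :
    IntervalIntegrable (cumulative dm u v g) volume u x :=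
  (intervalIntegrable_iff_integrableOn_Ioc_of_le hx.1).mpr
    (((memLp_cumulative g 1).integrable le_rfl).mono_measure
      (Measure.restrict_mono (Ioc_subset_Ioc le_rfl hx.2) le_rfl))

/-- By Fubini the adjoint integrates `g` over the points to the right of `y`, which is the total
integral minus the cumulative one. This brings $\int_{[u,y)} g\,dm$ into the eigenvalue equation. -/
theorem coeFn_adjoint_primitiveOp (g : L2On dm u v) :
    (primitiveOp dm u v).adjoint g =ᵐ[volume.restrict (Ioc u v)]
      fun y => (∫ z, g z ∂(dm.restrict (Ioo u v))) - cumulative dm u v g y := by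
  set t := ∫ z, g z ∂(dm.restrict (Ioo u v)) with ht
  have hm : MemLp (fun y => t - cumulative dm u v g y) 2 (volume.restrict (Ioc u v)) :=
    (memLp_const t).sub (memLp_cumulative g 2)
  have key : (primitiveOp dm u v).adjoint g = hm.toLp _ := by
    refine ext_inner_right ℝ fun k => ?_
    rw [ContinuousLinearMap.adjoint_inner_left, L2.inner_eq_integral_mul,
      L2.inner_eq_integral_mul]
    have hk : Integrable k (volume.restrict (Ioc u v)) := k.integrableOn
    have h1 : ∫ y in Ioc u v, (hm.toLp _ : DerivSpace u v) y * k y =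
        ∫ y in Ioc u v, (t * k y - cumulative dm u v g y * k y) := by
      refine integral_congr_ae ?_
      filter_upwards [hm.coeFn_toLp] with y hy
      rw [hy]; ring
    have h2 : Integrable (fun y => cumulative dm u v g y * k y) (volume.restrict (Ioc u v)) :=
      (memLp_cumulative g 2).integrable_mul (Lp.memLp k)
    have h3 : Integrable (fun z => g z * ∫ y in z..v, k y) (dm.restrict (Ioo u v)) := by
      have h4 : Integrable (fun z => g z * ((∫ y in u..v, k y) - ∫ y in u..z, k y))
          (dm.restrict (Ioo u v)) :=
        (Lp.memLp g).integrable_mul ((memLp_const _).sub k.memLp_primitive)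
      refine h4.congr ?_
      filter_upwards [ae_restrict_mem measurableSet_Ioo] with z hz
      have hz' := Ioo_subset_Icc_self hz
      have huv := hz'.1.trans hz'.2
      rw [intervalIntegral.integral_interval_sub_left
        (k.intervalIntegrable ⟨le_rfl, huv⟩ ⟨huv, le_rfl⟩)
        (k.intervalIntegrable ⟨le_rfl, huv⟩ hz')]
    rw [h1, integral_sub (hk.const_mul t) h2, integral_cumulative_mul g.integrable hk,
      integral_const_mul, ht, ← integral_mul_const, ← integral_sub (g.integrable.mul_const _) h3]
    refine integral_congr_ae ?_
    filter_upwards [coeFn_primitiveOp (dm := dm) k, ae_restrict_mem measurableSet_Ioo] with z h4 hz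
    have hz' := Ioo_subset_Icc_self hz
    have huv := hz'.1.trans hz'.2
    rw [h4, ← intervalIntegral.integral_of_le huv,
      ← intervalIntegral.integral_add_adjacent_intervals
        (k.intervalIntegrable ⟨le_rfl, huv⟩ hz') (k.intervalIntegrable hz' ⟨huv, le_rfl⟩)]
    ring
  rw [key]
  exact hm.coeFn_toLp

end Operators

/-! ### Variational principles for the two boundary conditions. -/

section Rayleigh

open Set InnerProductSpace

variable {dm : Measure ℝ} [IsLocallyFiniteMeasure dm] {u v : ℝ}

/-- An eigenvector `h` of `(P J)† (P J)` or `(J Q)† (J Q)`, where `J` is `primitiveOp`, has a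
primitive that is an iterated integral of the corresponding eigenfunction. -/
theorem intervalIntegral_eq_of_adjoint_primitiveOp {h : DerivSpace u v} {f : L2On dm u v}
    {κ c t : ℝ} (hκ : κ ≠ 0)
    (ht : ∫ z, f z ∂(dm.restrict (Ioo u v)) = t)
    (hh : (primitiveOp dm u v).adjoint f - c • Lp.const 2 (volume.restrict (Ioc u v)) (1 : ℝ) =
      κ • h) {x : ℝ} (hx : x ∈ Icc u v) :
    ∫ y in u..x, h y =
      κ⁻¹ * (t - c) * (x - u) - iteratedIntegral dm u v (κ⁻¹ • f) x := by
  have h1 : ∀ᵐ y ∂(volume.restrict (Ioc u v)),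
      h y = κ⁻¹ * (t - c) - κ⁻¹ * cumulative dm u v f y := by
    have e : h = κ⁻¹ • ((primitiveOp dm u v).adjoint f -
        c • Lp.const 2 (volume.restrict (Ioc u v)) (1 : ℝ)) := by
      rw [hh, inv_smul_smul₀ hκ]
    rw [e]
    filter_upwards [coeFn_adjoint_primitiveOp f,
      Lp.coeFn_smul κ⁻¹ ((primitiveOp dm u v).adjoint f -
        c • Lp.const 2 (volume.restrict (Ioc u v)) (1 : ℝ)),
      Lp.coeFn_sub ((primitiveOp dm u v).adjoint f)
        (c • Lp.const 2 (volume.restrict (Ioc u v)) (1 : ℝ)),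
      Lp.coeFn_smul c (Lp.const 2 (volume.restrict (Ioc u v)) (1 : ℝ)),
      Lp.coeFn_const (p := 2) (μ := volume.restrict (Ioc u v)) (1 : ℝ)] with y h1 h2 h3 h4 h5
    rw [h2, Pi.smul_apply, h3, Pi.sub_apply, h4, Pi.smul_apply, h5, h1, ht]
    simp
    ring
  have h2 : ∫ y in u..x, h y = ∫ y in u..x, (κ⁻¹ * (t - c) - κ⁻¹ * cumulative dm u v f y) := by
    rw [intervalIntegral.integral_of_le hx.1, intervalIntegral.integral_of_le hx.1]
    exact integral_congr_ae (ae_restrict_of_ae_restrict_of_subset (Ioc_subset_Ioc le_rfl hx.2) h1)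
  rw [h2, intervalIntegral.integral_sub intervalIntegrable_const
    ((intervalIntegrable_cumulative f hx).const_mul _), intervalIntegral.integral_const,
    intervalIntegral.integral_const_mul, iteratedIntegral_smul, iteratedIntegral_eq, smul_eq_mul]
  ring

theorem inner_lpConst {α : Type*} [MeasurableSpace α] {ν : Measure α} [IsFiniteMeasure ν]
    (f : Lp ℝ 2 ν) : ⟪Lp.const 2 ν (1 : ℝ), f⟫_ℝ = ∫ x, f x ∂ν := by
  rw [L2.inner_eq_integral_mul]
  refine integral_congr_ae ?_
  filter_upwards [Lp.coeFn_const (p := 2) (μ := ν) (1 : ℝ)] with x hx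
  rw [hx]
  simp

/-- The projection of `f` off a vector differs from `f` by a multiple of that vector. -/
theorem exists_starProjection_orthogonal_span_singleton {E : Type*} [NormedAddCommGroup E]
    [InnerProductSpace ℝ E] (e f : E) : ∃ c : ℝ, (ℝ ∙ e)ᗮ.starProjection f = f - c • e := by
  obtain ⟨c, hc⟩ := Submodule.mem_span_singleton.mp
    (Submodule.starProjection_apply_mem (ℝ ∙ e) f)
  exact ⟨c, by rw [Submodule.starProjection_orthogonal_val, hc]⟩

theorem starProjection_orthogonal_span_singleton_eq {E : Type*} [NormedAddCommGroup E]
    [InnerProductSpace ℝ E] {e f : E} (h : ⟪e, f⟫_ℝ = 0) :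
    (ℝ ∙ e)ᗮ.starProjection f = f :=
  Submodule.starProjection_eq_self_iff.mpr (Submodule.mem_orthogonal_singleton_iff_inner_right.mpr h)

/-- The variational principle for the Dirichlet problem. -/
theorem dirichlet_mul_norm_sq_lt (huv : u < v) {x : ℝ} (k : DerivSpace u v)
    (hx : 0 ≤ x) (hk : ∫ y in u..v, k y = 0)
    (horth : ∀ ev ≤ x, ∀ f : L2On dm u v, DirichletGraph dm u v f (ev • f) →
      ⟪f, primitiveOp dm u v k⟫_ℝ = 0)
    (hk0 : primitiveOp dm u v k ≠ 0) :
    x * ‖primitiveOp dm u v k‖ ^ 2 < ‖k‖ ^ 2 := by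
  set e := Lp.const 2 (volume.restrict (Ioc u v)) (1 : ℝ) with he
  set J := primitiveOp dm u v with hJ
  -- The range of `Q` consists of the derivatives of mean zero, whose primitives vanish at both
  -- endpoints.
  set Q := (ℝ ∙ e)ᗮ.starProjection with hQ
  have hmem (h : DerivSpace u v) (hh : ∫ y in u..v, h y = 0) : Q h = h := by
    refine starProjection_orthogonal_span_singleton_eq ?_
    rw [he, inner_lpConst, ← intervalIntegral.integral_of_le huv.le, hh]
  have hadj : (J ∘L Q).adjoint = Q ∘L J.adjoint := by
    rw [ContinuousLinearMap.adjoint_comp, hQ, (isSelfAdjoint_starProjection _).adjoint_eq]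
  have hcomp : IsCompactOperator (J ∘L Q) := (isCompactOperator_primitiveOp huv).comp_clm Q
  have hAk : (J ∘L Q) k = J k := by rw [ContinuousLinearMap.comp_apply, hmem k hk]
  have key := mul_norm_sq_lt_of_orthogonal hcomp (x := x) (k := k) ?_
    (by rintro rfl; exact hk0 (map_zero J))
  · rwa [hAk] at key
  intro κ h hh hκx
  have hκ : 0 < κ := by
    by_contra! h0
    nlinarith
  set f := (J ∘L Q) h with hf
  have hQh : Q (J.adjoint f) = κ • h := by rw [← hh, hadj]; rfl
  -- As `κ ≠ 0`, the eigenvector `h` lies in the range of `Q`.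
  have hint : ∫ y in u..v, h y = 0 := by
    have h1 : κ • h ∈ (ℝ ∙ e)ᗮ := by
      rw [← hQh]; exact Submodule.starProjection_apply_mem _ _
    have h2 := Submodule.mem_orthogonal_singleton_iff_inner_right.mp h1
    rw [inner_smul_right, he, inner_lpConst, ← intervalIntegral.integral_of_le huv.le] at h2
    exact (mul_eq_zero.mp h2).resolve_left hκ.ne'
  have hfh : f = J h := by rw [hf, ContinuousLinearMap.comp_apply, hmem h hint]
  obtain ⟨c, hc⟩ := exists_starProjection_orthogonal_span_singleton e (J.adjoint f)
  have hprim {y : ℝ} (hy : y ∈ Icc u v) :=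
    intervalIntegral_eq_of_adjoint_primitiveOp hκ.ne' rfl (hc.symm.trans hQh) hy
  -- The condition at `v` forces the unknown slope to be the constant `β` of the Dirichlet graph.
  have hv := hprim ⟨huv.le, le_rfl⟩
  have hgraph : DirichletGraph dm u v f (κ⁻¹ • f) := by
    have h1 := coeFn_primitiveOp (dm := dm) h
    rw [← hJ, ← hfh] at h1
    filter_upwards [h1, ae_restrict_mem measurableSet_Ioo] with y h2 hy
    have h3 : v - u ≠ 0 := (sub_pos.mpr huv).ne'
    rw [hint] at hv
    rw [h2, hprim (Ioo_subset_Icc_self hy), sub_left_inj]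
    congr 1
    field_simp
    field_simp at hv
    linarith
  have h3 := horth κ⁻¹ ?_ f hgraph
  · have h4 : κ * ⟪h, k⟫_ℝ = 0 := by
      rw [← real_inner_smul_left, ← hh, ContinuousLinearMap.adjoint_inner_left, hAk, h3]
    exact (mul_eq_zero.mp h4).resolve_left hκ.ne'
  · rw [inv_le_iff_one_le_mul₀ hκ, mul_comm]; exact hκx

/-- The variational principle for the Neumann problem. -/
theorem neumann_mul_norm_sq_lt (huv : u < v) {x : ℝ} (hx : 0 ≤ x) (k : DerivSpace u v) (c : ℝ)
    {g : L2On dm u v} (hg : g = primitiveOp dm u v k + c • Lp.const 2 (dm.restrict (Ioo u v)) 1)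
    (horth : ∀ ev ≤ x, ∀ f : L2On dm u v, NeumannGraph dm u v f (ev • f) → ⟪f, g⟫_ℝ = 0)
    (hg0 : g ≠ 0) :
    x * ‖g‖ ^ 2 < ‖k‖ ^ 2 := by
  set e := Lp.const 2 (dm.restrict (Ioo u v)) (1 : ℝ) with he
  set J := primitiveOp dm u v with hJ
  set P := (ℝ ∙ e)ᗮ.starProjection with hP
  -- Constants satisfy the Neumann equation for `0 ≤ x`, so `g` has mean zero and the additive
  -- constant `c` is absorbed by `P`.
  have hgraph0 : NeumannGraph dm u v e ((0 : ℝ) • e) := by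
    refine ⟨?_, 1, ?_⟩
    · have := cumulative_smul 0 e v
      rw [cumulative] at this
      rw [this, zero_mul]
    · filter_upwards [Lp.coeFn_const (p := 2) (μ := dm.restrict (Ioo u v)) (1 : ℝ)] with y hy
      rw [iteratedIntegral_smul, hy]
      simp
  have hPe : P e = 0 := by
    rw [hP, Submodule.starProjection_orthogonal_val,
      Submodule.starProjection_eq_self_iff.mpr (Submodule.mem_span_singleton_self e), sub_self]
  have hAk : (P ∘L J) k = g := by
    have h1 : P g = g := starProjection_orthogonal_span_singleton_eq (horth 0 hx e hgraph0)
    rw [← h1, hg, map_add, map_smul, hPe, smul_zero, add_zero]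
    rfl
  have hadj : (P ∘L J).adjoint = J.adjoint ∘L P := by
    rw [ContinuousLinearMap.adjoint_comp, hP, (isSelfAdjoint_starProjection _).adjoint_eq]
  have hcomp : IsCompactOperator (P ∘L J) := (isCompactOperator_primitiveOp huv).clm_comp P
  have key := mul_norm_sq_lt_of_orthogonal hcomp (x := x) (k := k) ?_
    (by rintro rfl; exact hg0 (by rw [← hAk, map_zero]))
  · rwa [hAk] at key
  intro κ h hh hκx
  have hκ : 0 < κ := by
    by_contra! h0
    nlinarith
  set f := (P ∘L J) h with hf
  have hmean : ∫ z, f z ∂(dm.restrict (Ioo u v)) = 0 := by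
    rw [← inner_lpConst]
    exact Submodule.mem_orthogonal_singleton_iff_inner_right.mp
      (Submodule.starProjection_apply_mem _ _)
  have hPf : P f = f := starProjection_orthogonal_span_singleton_eq (by rw [he, inner_lpConst, hmean])
  have hJf : J.adjoint f = κ • h := by
    rw [← hh, hadj, ContinuousLinearMap.comp_apply, hPf]
  obtain ⟨d, hd⟩ := exists_starProjection_orthogonal_span_singleton e (J h)
  have hfd : f = J h - d • e := hd
  have hgraph : NeumannGraph dm u v f (κ⁻¹ • f) := by
    refine ⟨?_, -d, ?_⟩
    · have h1 := cumulative_smul κ⁻¹ f v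
      rw [cumulative] at h1
      rw [h1, cumulative, Measure.restrict_restrict measurableSet_Ico,
        inter_eq_right.mpr Ioo_subset_Ico_self, hmean, mul_zero]
    · have h1 := Lp.coeFn_sub (J h) (d • e)
      rw [← hfd] at h1
      filter_upwards [h1, Lp.coeFn_smul d e, coeFn_primitiveOp (dm := dm) h,
        Lp.coeFn_const (p := 2) (μ := dm.restrict (Ioo u v)) (1 : ℝ),
        ae_restrict_mem measurableSet_Ioo] with y h1 h2 h3 h4 hy
      have h5 := intervalIntegral_eq_of_adjoint_primitiveOp (c := 0) hκ.ne' hmean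
        (by rw [zero_smul, sub_zero]; exact hJf) (Ioo_subset_Icc_self hy)
      rw [h1, Pi.sub_apply, h2, Pi.smul_apply, h4, h3, h5]
      simp
      ring
  have h3 := horth κ⁻¹ ?_ f hgraph
  · have h4 : κ * ⟪h, k⟫_ℝ = 0 := by
      rw [← real_inner_smul_left, ← hh, ContinuousLinearMap.adjoint_inner_left, hAk, h3]
    exact (mul_eq_zero.mp h4).resolve_left hκ.ne'
  · rw [inv_le_iff_one_le_mul₀ hκ, mul_comm]; exact hκx

end Rayleigh

/-! ### Mass and energy forms on pairs of a function and its derivative. -/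

section Forms

open Set InnerProductSpace

/-- Bounded Borel functions on the line. -/
def boundedMeasurable : Submodule ℝ (ℝ → ℝ) where
  carrier := {f | Measurable f ∧ ∃ C, ∀ x, |f x| ≤ C}
  add_mem' := by
    rintro f g ⟨hf, C, hC⟩ ⟨hg, D, hD⟩
    exact ⟨hf.add hg, C + D, fun x => (abs_add_le _ _).trans (add_le_add (hC x) (hD x))⟩
  zero_mem' := ⟨measurable_zero, 0, by simp⟩
  smul_mem' := by
    rintro c f ⟨hf, C, hC⟩
    refine ⟨hf.const_smul c, |c| * C, fun x => ?_⟩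
    rw [Pi.smul_apply, smul_eq_mul, abs_mul]
    exact mul_le_mul_of_nonneg_left (hC x) (abs_nonneg c)

/-- The type of bounded Borel functions on the line. -/
abbrev BddBorel : Type := boundedMeasurable

namespace BddBorel

variable (f g : BddBorel) (ν : Measure ℝ) [IsFiniteMeasure ν]

theorem measurable : Measurable (f : ℝ → ℝ) := f.2.1

theorem memLp (p : ENNReal) : MemLp (f : ℝ → ℝ) p ν := by
  obtain ⟨C, hC⟩ := f.2.2
  exact MemLp.of_bound f.2.1.aestronglyMeasurable C (ae_of_all _ hC)

theorem integrable : Integrable (f : ℝ → ℝ) ν := (f.memLp ν 1).integrable le_rfl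

theorem integrable_mul : Integrable (fun x => f.1 x * g.1 x) ν :=
  (f.memLp ν 2).integrable_mul (g.memLp ν 2)

theorem intervalIntegrable (s t : ℝ) : IntervalIntegrable (f : ℝ → ℝ) volume s t :=
  ⟨f.integrable (volume.restrict (Ioc s t)), f.integrable (volume.restrict (Ioc t s))⟩

end BddBorel

/-- The bilinear form `∫ f g dν` on bounded Borel functions. -/
noncomputable def integralForm (ν : Measure ℝ) [IsFiniteMeasure ν] :
    LinearMap.BilinForm ℝ BddBorel :=
  LinearMap.mk₂ ℝ (fun f g : BddBorel => ∫ x, f.1 x * g.1 x ∂ν)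
    (fun f f' g => by
      rw [← integral_add (f.integrable_mul g ν) (f'.integrable_mul g ν)]
      simp [add_mul])
    (fun c f g => by
      rw [smul_eq_mul, ← integral_const_mul]
      simp [mul_assoc])
    (fun f g g' => by
      rw [← integral_add (f.integrable_mul g ν) (f.integrable_mul g' ν)]
      simp [mul_add])
    (fun c f g => by
      rw [smul_eq_mul, ← integral_const_mul]
      simp [mul_left_comm])

/-- Pairs of a function and its derivative. -/
abbrev FunctionPair : Type := BddBorel × BddBorel

/-- The form `∫_{(u,v)} F G dm`. -/
noncomputable def massForm (dm : Measure ℝ) [IsLocallyFiniteMeasure dm] (u v : ℝ) :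
    LinearMap.BilinForm ℝ FunctionPair :=
  (integralForm (dm.restrict (Ioo u v))).compl₁₂ (LinearMap.fst ℝ _ _) (LinearMap.fst ℝ _ _)

/-- The form `∫_u^v F' G' dx`. -/
noncomputable def energyForm (u v : ℝ) : LinearMap.BilinForm ℝ FunctionPair :=
  (integralForm (volume.restrict (Ioc u v))).compl₁₂ (LinearMap.snd ℝ _ _) (LinearMap.snd ℝ _ _)

/-- The form domain of the Neumann problem on `[u, v]`. -/
def neumannForms (u v : ℝ) : Submodule ℝ FunctionPair where
  carrier := {w | ∀ x ∈ Icc u v, w.1.1 x = w.1.1 u + ∫ y in u..x, w.2.1 y}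
  add_mem' := by
    intro w w' hw hw' x hx
    have h1 := intervalIntegral.integral_add (w.2.intervalIntegrable u x)
      (w'.2.intervalIntegrable u x)
    simp only [Prod.fst_add, Prod.snd_add, Submodule.coe_add, Pi.add_apply, hw x hx, hw' x hx, h1]
    ring
  zero_mem' := by intro x _; simp
  smul_mem' := by
    intro c w hw x hx
    have h1 : ∫ y in u..x, c * w.2.1 y = c * ∫ y in u..x, w.2.1 y :=
      intervalIntegral.integral_const_mul _ _
    simp only [Prod.smul_fst, Prod.smul_snd, Submodule.coe_smul, Pi.smul_apply, smul_eq_mul,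
      hw x hx, h1]
    ring

/-- The form domain of the Dirichlet problem on `[u, v]`. -/
def dirichletForms (u v : ℝ) : Submodule ℝ FunctionPair where
  carrier := {w | w ∈ neumannForms u v ∧ w.1.1 u = 0 ∧ w.1.1 v = 0}
  add_mem' := by
    rintro w w' ⟨h, hu, hv⟩ ⟨h', hu', hv'⟩
    exact ⟨add_mem h h', by simp [hu, hu'], by simp [hv, hv']⟩
  zero_mem' := ⟨zero_mem _, by simp, by simp⟩
  smul_mem' := by
    rintro c w ⟨h, hu, hv⟩
    exact ⟨Submodule.smul_mem _ c h, by simp [hu], by simp [hv]⟩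

theorem dirichletForms_le_neumannForms (u v : ℝ) : dirichletForms u v ≤ neumannForms u v :=
  fun _ h => h.1

/-- Evaluation of the function at a point. -/
def evalAt (x : ℝ) : FunctionPair →ₗ[ℝ] ℝ where
  toFun w := w.1.1 x
  map_add' _ _ := rfl
  map_smul' _ _ := rfl

variable {dm : Measure ℝ} [IsLocallyFiniteMeasure dm] {u v : ℝ}

theorem massForm_apply (w w' : FunctionPair) :
    massForm dm u v w w' = ∫ x, w.1.1 x * w'.1.1 x ∂(dm.restrict (Ioo u v)) := rfl

theorem energyForm_apply (w w' : FunctionPair) :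
    energyForm u v w w' = ∫ y in Ioc u v, w.2.1 y * w'.2.1 y := rfl

theorem massForm_comm (w w' : FunctionPair) : massForm dm u v w w' = massForm dm u v w' w := by
  simp_rw [massForm_apply, mul_comm]

theorem energyForm_comm (w w' : FunctionPair) : energyForm u v w w' = energyForm u v w' w := by
  simp_rw [energyForm_apply, mul_comm]

theorem massForm_self_nonneg (w : FunctionPair) : 0 ≤ massForm dm u v w w :=
  integral_nonneg fun _ => mul_self_nonneg _

theorem energyForm_self_nonneg (w : FunctionPair) : 0 ≤ energyForm u v w w :=
  integral_nonneg fun _ => mul_self_nonneg _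

/-- A form function vanishing on a fine grid has small mass compared with its energy. -/
theorem massForm_le_of_grid (huv : u < v) {N : ℕ} (hN : 0 < N) {w : FunctionPair}
    (hw : w ∈ neumannForms u v)
    (hgrid : ∀ j : Fin (N + 1), evalAt (u + j * ((v - u) / N)) w = 0) :
    massForm dm u v w w ≤
      ((v - u) / N) * (dm.restrict (Ioo u v)).real univ * energyForm u v w w := by
  have hN' : (0 : ℝ) < N := by exact_mod_cast hN
  have hδ : 0 ≤ (v - u) / N := div_nonneg (sub_pos.mpr huv).le hN'.le
  have hu : w.1.1 u = 0 := by simpa [evalAt] using hgrid 0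
  have hw' {x : ℝ} (hx : x ∈ Icc u v) : w.1.1 x = ∫ y in u..x, w.2.1 y := by
    rw [hw x hx, hu, zero_add]
  have hpt : ∀ x ∈ Icc u v, w.1.1 x * w.1.1 x ≤ ((v - u) / N) * energyForm u v w w := by
    intro x hx
    have h1 := sq_intervalIntegral_le_of_grid huv hN (w.2.memLp (volume.restrict (Ioc u v)) 2)
      (fun j => ?_) hx
    · rw [hw' hx, ← sq, energyForm_apply]
      simp_rw [← sq]
      exact h1
    · have hj : (j : ℝ) * ((v - u) / N) ≤ v - u := by
        have h2 : (j : ℝ) ≤ N := by exact_mod_cast Nat.lt_succ_iff.mp j.2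
        calc (j : ℝ) * ((v - u) / N) ≤ N * ((v - u) / N) := mul_le_mul_of_nonneg_right h2 hδ
          _ = v - u := by field_simp
      have hj0 := mul_nonneg (Nat.cast_nonneg (α := ℝ) j) hδ
      rw [← hw' ⟨by linarith, by linarith⟩]
      exact hgrid j
  calc massForm dm u v w w
      ≤ ∫ _, ((v - u) / N) * energyForm u v w w ∂(dm.restrict (Ioo u v)) := by
        refine integral_mono_ae (w.1.integrable_mul w.1 _) (integrable_const _) ?_
        filter_upwards [ae_restrict_mem measurableSet_Ioo] with x hx
        exact hpt x (Ioo_subset_Icc_self hx)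
    _ = _ := by rw [integral_const, smul_eq_mul]; ring

/-- The function pair on `[u, v]` with the value `c` at `u` and the derivative
`β - ∫_{[u, y)} g dm` at `y`. -/
theorem exists_functionPair (c β : ℝ) (g : L2On dm u v) :
    ∃ w ∈ neumannForms u v, (∀ y, w.2.1 y = β - cumulative dm u v g y) ∧
      ∀ x ∈ Icc u v, w.1.1 x = c + β * (x - u) - iteratedIntegral dm u v g x := by
  set D := ∫ z, |g z| ∂(dm.restrict (Ioo u v)) with hD
  have hh : (fun y => β - cumulative dm u v g y) ∈ boundedMeasurable := by
    refine ⟨measurable_const.sub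
      (stronglyMeasurable_cumulative (Lp.stronglyMeasurable g)).measurable, |β| + D, fun y => ?_⟩
    exact (abs_sub _ _).trans (add_le_add le_rfl (abs_cumulative_le g.integrable y))
  have hcont : ContinuousOn (iteratedIntegral dm u v g) (Icc u v) := by
    have h1 : IntegrableOn (cumulative dm u v g) (Icc u v) :=
      (integrableOn_Icc_iff_integrableOn_Ioc (by finiteness)).mpr
        ((memLp_cumulative g 1).integrable le_rfl)
    exact (intervalIntegral.continuousOn_primitive h1).congr fun x hx =>
      intervalIntegral.integral_of_le hx.1
  have hF : (Icc u v).indicator (fun x => c + β * (x - u) - iteratedIntegral dm u v g x) ∈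
      boundedMeasurable := by
    have h2 : ContinuousOn (fun x => c + β * (x - u) - iteratedIntegral dm u v g x) (Icc u v) :=
      (by fun_prop : Continuous fun x : ℝ => c + β * (x - u)).continuousOn.sub hcont
    refine ⟨?_, ?_⟩
    · classical
      rw [← piecewise_eq_indicator]
      exact h2.measurable_piecewise continuousOn_const measurableSet_Icc
    · obtain ⟨C, hC⟩ := isCompact_Icc.exists_bound_of_continuousOn h2
      refine ⟨max C 0, fun x => ?_⟩
      by_cases hx : x ∈ Icc u v
      · rw [indicator_of_mem hx]; exact le_max_of_le_left (hC x hx)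
      · rw [indicator_of_notMem hx]; simp
  refine ⟨(⟨_, hF⟩, ⟨_, hh⟩), fun x hx => ?_, fun y => rfl,
    fun x hx => indicator_of_mem hx (fun x => c + β * (x - u) - iteratedIntegral dm u v g x)⟩
  have hu : u ∈ Icc u v := ⟨le_rfl, hx.1.trans hx.2⟩
  simp only [indicator_of_mem hx, indicator_of_mem hu]
  rw [intervalIntegral.integral_sub intervalIntegrable_const (intervalIntegrable_cumulative g hx),
    intervalIntegral.integral_const, iteratedIntegral_eq, iteratedIntegral_eq,
    intervalIntegral.integral_same, smul_eq_mul]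
  ring

/-- Green's formula. -/
theorem energyForm_eq_of_derivative (huv : u < v) {w w' : FunctionPair} {β : ℝ} {g : L2On dm u v}
    (hw : ∀ y, w.2.1 y = β - cumulative dm u v g y) (hw' : w' ∈ neumannForms u v) :
    energyForm u v w w' = β * (w'.1.1 v - w'.1.1 u) -
      ∫ z, g z * (w'.1.1 v - w'.1.1 z) ∂(dm.restrict (Ioo u v)) := by
  have hk : IntegrableOn w'.2.1 (Ioc u v) := w'.2.integrable _
  have h1 (y : ℝ) : w.2.1 y * w'.2.1 y = β * w'.2.1 y - cumulative dm u v g y * w'.2.1 y := by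
    rw [hw]; ring
  have h2 : Integrable (fun y => cumulative dm u v g y * w'.2.1 y) (volume.restrict (Ioc u v)) :=
    (memLp_cumulative g 2).integrable_mul (w'.2.memLp _ 2)
  have hv := hw' v ⟨huv.le, le_rfl⟩
  rw [energyForm_apply]
  simp_rw [h1]
  rw [integral_sub (hk.const_mul β) h2, integral_const_mul, integral_cumulative_mul g.integrable hk,
    ← intervalIntegral.integral_of_le huv.le]
  congr 1
  · rw [hv]; ring
  · refine integral_congr_ae ?_
    filter_upwards [ae_restrict_mem measurableSet_Ioo] with z hz
    rw [hv, hw' z (Ioo_subset_Icc_self hz), ← intervalIntegral.integral_add_adjacent_intervals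
      (w'.2.intervalIntegrable u z) (w'.2.intervalIntegrable z v)]
    ring

end Forms

/-! ### Simplicity of eigenvalues and the form description of both problems. -/

section Eigenfunctions

open Set InnerProductSpace

variable {dm : Measure ℝ} [IsLocallyFiniteMeasure dm] {u v : ℝ}

theorem iteratedIntegral_sub (f g : L2On dm u v) {x : ℝ} (hx : x ∈ Icc u v) :
    iteratedIntegral dm u v (f - g) x = iteratedIntegral dm u v f x - iteratedIntegral dm u v g x := by
  have h1 (y : ℝ) : cumulative dm u v (f - g : L2On dm u v) y =
      cumulative dm u v f y - cumulative dm u v g y := by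
    rw [cumulative_congr (Lp.coeFn_sub f g), cumulative, cumulative, cumulative,
      ← integral_sub f.integrable.restrict g.integrable.restrict]
    rfl
  simp_rw [iteratedIntegral_eq, h1]
  exact intervalIntegral.integral_sub (intervalIntegrable_cumulative f hx)
    (intervalIntegrable_cumulative g hx)

/-- Uniqueness for the Volterra equation `f = -ev ∫_u^x dy ∫_{[u, y)} f dm`. -/
theorem eq_zero_of_eq_neg_iteratedIntegral {ev : ℝ} {f : L2On dm u v}
    (hf : ∀ᵐ x ∂(dm.restrict (Ioo u v)), f x = -iteratedIntegral dm u v (ev • f) x) : f = 0 := by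
  set μ := dm.restrict (Ioo u v) with hμ
  set K := |ev| * μ.real univ with hK
  set D := ∫ z, |f z| ∂μ with hD
  have hD0 : 0 ≤ D := integral_nonneg fun z => abs_nonneg _
  have hcum {B : ℝ → ℝ} {y : ℝ} (hB : ∀ z ∈ Ioo u v, z < y → |iteratedIntegral dm u v (ev • f) z| ≤ B y)
      (hB0 : 0 ≤ B y) : |cumulative dm u v f y| ≤ μ.real univ * B y := by
    refine abs_integral_le_integral_abs.trans ?_
    calc ∫ z in Ico u y, |f z| ∂μ ≤ ∫ z in Ico u y, B y ∂μ := by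
          refine integral_mono_ae f.integrable.abs.restrict (integrable_const _) ?_
          filter_upwards [ae_restrict_mem measurableSet_Ico, ae_restrict_of_ae hf,
            ae_restrict_of_ae (ae_restrict_mem measurableSet_Ioo)] with z h1 h2 h3
          rw [h2, abs_neg]
          exact hB z h3 h1.2
      _ = (μ.restrict (Ico u y)).real univ * B y := by rw [integral_const, smul_eq_mul]
      _ ≤ μ.real univ * B y := by
          refine mul_le_mul_of_nonneg_right ?_ hB0
          rw [measureReal_restrict_apply_univ]
          exact measureReal_mono (subset_univ _)
  have hstep {B : ℝ → ℝ} (hBc : Continuous B) {x : ℝ} (hx : x ∈ Icc u v)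
      (hB : ∀ y ∈ Icc u v, |cumulative dm u v f y| ≤ B y) :
      |iteratedIntegral dm u v (ev • f) x| ≤ |ev| * ∫ y in u..x, B y := by
    rw [iteratedIntegral_smul, abs_mul, iteratedIntegral_eq]
    refine mul_le_mul_of_nonneg_left ?_ (abs_nonneg _)
    refine (intervalIntegral.abs_integral_le_integral_abs hx.1).trans ?_
    exact intervalIntegral.integral_mono_on hx.1 (intervalIntegrable_cumulative f hx).abs
      (hBc.intervalIntegrable _ _) fun y hy => hB y ⟨hy.1, hy.2.trans hx.2⟩
  -- Picard iteration: each pass through the equation integrates the previous bound once in `y`, and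
  -- the factorial drives the bound to zero.
  have main (n : ℕ) : ∀ x ∈ Icc u v, |iteratedIntegral dm u v (ev • f) x| ≤
      |ev| * D * (v - u) * ((K * (x - u)) ^ n / n.factorial) := by
    induction n with
    | zero =>
      intro x hx
      refine (hstep continuous_const hx fun y _ => abs_cumulative_le f.integrable y).trans ?_
      rw [intervalIntegral.integral_const, smul_eq_mul, pow_zero, Nat.factorial_zero, Nat.cast_one,
        div_one, mul_one, mul_assoc, mul_comm D]
      have h1 : x - u ≤ v - u := by linarith [hx.2]
      gcongr
    | succ n ih =>
      intro x hx
      have hM : 0 ≤ |ev| * D * (v - u) :=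
        mul_nonneg (mul_nonneg (abs_nonneg _) hD0) (by linarith [hx.1, hx.2])
      have hKn : 0 ≤ K := mul_nonneg (abs_nonneg _) measureReal_nonneg
      have h1 : ∀ y ∈ Icc u v, |cumulative dm u v f y| ≤
          μ.real univ * (|ev| * D * (v - u) * ((K * (y - u)) ^ n / n.factorial)) := by
        intro y hy
        refine hcum (B := fun y => |ev| * D * (v - u) * ((K * (y - u)) ^ n / n.factorial))
          (fun z hz hzy => (ih z (Ioo_subset_Icc_self hz)).trans ?_) ?_
        · have := hz.1
          have h3 : 0 ≤ K * (z - u) := mul_nonneg hKn (by linarith)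
          gcongr
        · have h3 : 0 ≤ K * (y - u) := mul_nonneg hKn (by linarith [hy.1])
          positivity
      refine (hstep (by fun_prop) hx h1).trans (le_of_eq ?_)
      have h2 : ∀ y, μ.real univ * (|ev| * D * (v - u) * ((K * (y - u)) ^ n / n.factorial)) =
          (μ.real univ * (|ev| * D * (v - u)) * K ^ n / n.factorial) * (y - u) ^ n := fun y => by
        rw [mul_pow]; ring
      simp_rw [h2]
      rw [intervalIntegral.integral_const_mul,
        intervalIntegral.integral_comp_sub_right (fun y => y ^ n), integral_pow, sub_self,
        Nat.factorial_succ, mul_pow K (x - u), zero_pow n.succ_ne_zero, sub_zero]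
      have h3 : K ^ (n + 1) = K ^ n * (|ev| * μ.real univ) := pow_succ K n
      rw [h3]
      push_cast
      generalize |ev| = A
      field_simp
  have hzero : ∀ x ∈ Icc u v, iteratedIntegral dm u v (ev • f) x = 0 := by
    intro x hx
    have h1 : Filter.Tendsto
        (fun n : ℕ => |ev| * D * (v - u) * ((K * (x - u)) ^ n / n.factorial)) Filter.atTop
        (nhds (|ev| * D * (v - u) * 0)) :=
      (FloorSemiring.tendsto_pow_div_factorial_atTop (K * (x - u))).const_mul _
    rw [mul_zero] at h1
    exact abs_nonpos_iff.mp (ge_of_tendsto' h1 fun n => main n x hx)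
  refine Lp.ext ?_
  filter_upwards [hf, Lp.coeFn_zero ℝ 2 μ, ae_restrict_mem measurableSet_Ioo] with x h1 h2 hx
  rw [h1, h2, hzero x (Ioo_subset_Icc_self hx)]
  simp

/-- Solutions of the Volterra equation with proportional inhomogeneities are proportional. -/
theorem exists_eq_smul_of_eq_sub_iteratedIntegral {ev c₁ c₂ : ℝ} {φ : ℝ → ℝ} {f₁ f₂ : L2On dm u v}
    (h₁ : ∀ᵐ x ∂(dm.restrict (Ioo u v)), f₁ x = c₁ * φ x - iteratedIntegral dm u v (ev • f₁) x)
    (h₂ : ∀ᵐ x ∂(dm.restrict (Ioo u v)), f₂ x = c₂ * φ x - iteratedIntegral dm u v (ev • f₂) x)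
    (hf : f₁ ≠ 0) : ∃ a : ℝ, f₂ = a • f₁ := by
  -- With `c₁ = 0` the equation is homogeneous and uniqueness would give `f₁ = 0`.
  have hc : c₁ ≠ 0 := by
    rintro rfl
    exact hf (eq_zero_of_eq_neg_iteratedIntegral (ev := ev) (by simpa using h₁))
  refine ⟨c₁⁻¹ * c₂, ?_⟩
  have hzero : f₂ - (c₁⁻¹ * c₂) • f₁ = 0 := by
    refine eq_zero_of_eq_neg_iteratedIntegral (ev := ev) ?_
    filter_upwards [h₁, h₂, Lp.coeFn_sub f₂ ((c₁⁻¹ * c₂) • f₁), Lp.coeFn_smul (c₁⁻¹ * c₂) f₁,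
      ae_restrict_mem measurableSet_Ioo] with x h1 h2 h3 h4 hx
    rw [h3, Pi.sub_apply, h4, Pi.smul_apply, h1, h2, smul_sub ev f₂, smul_comm ev _ f₁,
      iteratedIntegral_sub _ _ (Ioo_subset_Icc_self hx), iteratedIntegral_smul (c₁⁻¹ * c₂),
      smul_eq_mul]
    field_simp
    ring
  exact sub_eq_zero.mp hzero

/-- A self-adjoint boundary value problem: the operator with graph `G` is represented by
`energyForm` on the form domain `V`, has simple eigenvalues, and obeys the min-max principle. -/
structure IsFormProblem (dm : Measure ℝ) [IsLocallyFiniteMeasure dm] (u v : ℝ)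
    (V : Submodule ℝ FunctionPair) (G : L2On dm u v → L2On dm u v → Prop) : Prop where
  le_neumannForms : V ≤ neumannForms u v
  weak : ∀ (ev : ℝ) (f : L2On dm u v), G f (ev • f) →
    ∃ w ∈ V, f =ᵐ[dm.restrict (Ioo u v)] w.1.1 ∧
      ∀ w' ∈ V, energyForm u v w w' = ev * massForm dm u v w w'
  simple : ∀ (ev : ℝ) (f f' : L2On dm u v), f ≠ 0 → G f (ev • f) → G f' (ev • f') →
    ∃ a : ℝ, f' = a • f
  variational : ∀ x : ℝ, 0 ≤ x → ∀ w ∈ V,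
    (∀ ev ≤ x, ∀ f : L2On dm u v, G f (ev • f) →
      ∫ z, f z * w.1.1 z ∂(dm.restrict (Ioo u v)) = 0) →
    0 < massForm dm u v w w → x * massForm dm u v w w < energyForm u v w w

theorem energyForm_eq_norm_sq (w : FunctionPair) :
    energyForm u v w w = ‖(w.2.memLp (volume.restrict (Ioc u v)) 2).toLp _‖ ^ 2 := by
  rw [DerivSpace.norm_sq, energyForm_apply]
  refine integral_congr_ae ?_
  filter_upwards [(w.2.memLp (volume.restrict (Ioc u v)) 2).coeFn_toLp] with y hy
  rw [hy, sq]

theorem massForm_eq_norm_sq {w : FunctionPair} {g : L2On dm u v}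
    (hg : g =ᵐ[dm.restrict (Ioo u v)] w.1.1) : massForm dm u v w w = ‖g‖ ^ 2 := by
  rw [← real_inner_self_eq_norm_sq, L2.inner_eq_integral_mul, massForm_apply]
  refine integral_congr_ae ?_
  filter_upwards [hg] with y hy
  rw [hy]

theorem intervalIntegral_toLp_derivative (w : FunctionPair) {x : ℝ} (hx : x ∈ Icc u v) :
    ∫ y in u..x, ((w.2.memLp (volume.restrict (Ioc u v)) 2).toLp _ : DerivSpace u v) y =
      ∫ y in u..x, w.2.1 y := by
  rw [intervalIntegral.integral_of_le hx.1, intervalIntegral.integral_of_le hx.1]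
  exact integral_congr_ae (ae_restrict_of_ae_restrict_of_subset (Ioc_subset_Ioc le_rfl hx.2)
    (MemLp.coeFn_toLp _))

/-- In Green's formula the boundary terms drop out because test functions vanish at both endpoints.
The solution is fixed by its slope at `u`, hence simplicity. -/
theorem isFormProblem_dirichlet (huv : u < v) :
    IsFormProblem dm u v (dirichletForms u v) (DirichletGraph dm u v) where
  le_neumannForms := dirichletForms_le_neumannForms u v
  weak ev f hf := by
    obtain ⟨w, hw, hw2, hw1⟩ := exists_functionPair 0
      ((v - u)⁻¹ * iteratedIntegral dm u v (ev • f) v) (ev • f)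
    have hfw : f =ᵐ[dm.restrict (Ioo u v)] w.1.1 := by
      filter_upwards [hf, ae_restrict_mem measurableSet_Ioo] with x h1 hx
      rw [h1, hw1 x (Ioo_subset_Icc_self hx), zero_add]
    refine ⟨w, ⟨hw, ?_, ?_⟩, hfw, fun w' hw' => ?_⟩
    · rw [hw1 u ⟨le_rfl, huv.le⟩]; simp [iteratedIntegral_eq]
    · rw [hw1 v ⟨huv.le, le_rfl⟩]
      have : v - u ≠ 0 := (sub_pos.mpr huv).ne'
      field_simp
      ring
    · rw [energyForm_eq_of_derivative huv hw2 hw'.1, hw'.2.1, hw'.2.2, massForm_apply,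
        ← integral_const_mul, sub_self, mul_zero, zero_sub, ← integral_neg]
      refine integral_congr_ae ?_
      filter_upwards [hfw, Lp.coeFn_smul ev f] with z h1 h2
      rw [h2, Pi.smul_apply, h1, smul_eq_mul]
      ring
  simple ev f f' hf0 hf hf' := exists_eq_smul_of_eq_sub_iteratedIntegral hf hf' hf0
  variational x hx w hw horth hpos := by
    set k : DerivSpace u v := (w.2.memLp (volume.restrict (Ioc u v)) 2).toLp _ with hk
    have hJ : primitiveOp dm u v k =ᵐ[dm.restrict (Ioo u v)] w.1.1 := by
      filter_upwards [coeFn_primitiveOp (dm := dm) k, ae_restrict_mem measurableSet_Ioo] with y h1 hy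
      rw [h1, hk, intervalIntegral_toLp_derivative w (Ioo_subset_Icc_self hy),
        hw.1 y (Ioo_subset_Icc_self hy), hw.2.1, zero_add]
    rw [energyForm_eq_norm_sq, massForm_eq_norm_sq hJ]
    rw [massForm_eq_norm_sq hJ] at hpos
    refine dirichlet_mul_norm_sq_lt huv k hx ?_ (fun ev hev f hf => ?_)
      (by rintro h; simp [h] at hpos)
    · rw [hk, intervalIntegral_toLp_derivative w ⟨huv.le, le_rfl⟩]
      have := hw.1 v ⟨huv.le, le_rfl⟩
      rw [hw.2.1, hw.2.2] at this
      linarith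
    · rw [L2.inner_eq_integral_mul, ← horth ev hev f hf]
      refine integral_congr_ae ?_
      filter_upwards [hJ] with y hy
      rw [hy]

/-- In Green's formula the slope is `0` and the mean-zero condition on `ev • f` removes the value of
the test function at `v`. The solution is fixed by the constant `c`, hence simplicity. -/
theorem isFormProblem_neumann (huv : u < v) :
    IsFormProblem dm u v (neumannForms u v) (NeumannGraph dm u v) where
  le_neumannForms := le_rfl
  weak ev f hf := by
    obtain ⟨hmean, c, hf⟩ := hf
    obtain ⟨w, hw, hw2, hw1⟩ := exists_functionPair c 0 (ev • f)
    have hfw : f =ᵐ[dm.restrict (Ioo u v)] w.1.1 := by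
      filter_upwards [hf, ae_restrict_mem measurableSet_Ioo] with x h1 hx
      rw [h1, hw1 x (Ioo_subset_Icc_self hx), zero_mul, add_zero]
    refine ⟨w, hw, hfw, fun w' hw' => ?_⟩
    rw [Measure.restrict_restrict measurableSet_Ico,
      inter_eq_right.mpr Ioo_subset_Ico_self] at hmean
    have h1 : Integrable (fun z => (ev • f : L2On dm u v) z * w'.1.1 z) (dm.restrict (Ioo u v)) :=
      (Lp.memLp (ev • f)).integrable_mul (w'.1.memLp _ 2)
    simp_rw [energyForm_eq_of_derivative huv hw2 hw', mul_sub]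
    rw [integral_sub ((ev • f : L2On dm u v).integrable.mul_const _) h1, integral_mul_const, hmean,
      massForm_apply, ← integral_const_mul, zero_mul, zero_mul, sub_self, zero_sub,
      zero_sub, neg_neg]
    refine integral_congr_ae ?_
    filter_upwards [hfw, Lp.coeFn_smul ev f] with z h1 h2
    rw [h2, Pi.smul_apply, h1, smul_eq_mul]
    ring
  simple ev f f' hf0 hf hf' := by
    obtain ⟨-, c, hf⟩ := hf
    obtain ⟨-, c', hf'⟩ := hf'
    exact exists_eq_smul_of_eq_sub_iteratedIntegral (c₁ := c) (c₂ := c') (φ := fun _ => 1) (ev := ev)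
      (by simpa using hf) (by simpa using hf') hf0
  variational x hx w hw horth hpos := by
    set k : DerivSpace u v := (w.2.memLp (volume.restrict (Ioc u v)) 2).toLp _ with hk
    set g : L2On dm u v :=
      primitiveOp dm u v k + w.1.1 u • Lp.const 2 (dm.restrict (Ioo u v)) 1 with hg
    have hJ : g =ᵐ[dm.restrict (Ioo u v)] w.1.1 := by
      filter_upwards [coeFn_primitiveOp (dm := dm) k, ae_restrict_mem measurableSet_Ioo,
        Lp.coeFn_add (primitiveOp dm u v k) (w.1.1 u • Lp.const 2 (dm.restrict (Ioo u v)) 1),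
        Lp.coeFn_smul (w.1.1 u) (Lp.const 2 (dm.restrict (Ioo u v)) (1 : ℝ)),
        Lp.coeFn_const (p := 2) (μ := dm.restrict (Ioo u v)) (1 : ℝ)] with y h1 hy h2 h3 h4
      rw [hg, h2, Pi.add_apply, h3, Pi.smul_apply, h4, h1, hk,
        intervalIntegral_toLp_derivative w (Ioo_subset_Icc_self hy),
        hw y (Ioo_subset_Icc_self hy)]
      simp
      ring
    rw [energyForm_eq_norm_sq, massForm_eq_norm_sq hJ]
    rw [massForm_eq_norm_sq hJ] at hpos
    refine neumann_mul_norm_sq_lt huv hx k (w.1.1 u) hg (fun ev hev f hf => ?_)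
      (by rintro h; simp [h] at hpos)
    rw [L2.inner_eq_integral_mul, ← horth ev hev f hf]
    refine integral_congr_ae ?_
    filter_upwards [hJ] with y hy
    rw [hy]

end Eigenfunctions

/-! ### Finite eigensystems and the Dirichlet–Neumann comparison on one interval. -/

section Systems

open Set

variable {dm : Measure ℝ} [IsLocallyFiniteMeasure dm] {u v x : ℝ} {V : Submodule ℝ FunctionPair}
  {G : L2On dm u v → L2On dm u v → Prop}

/-- The eigenvalues at most `x` of the operator with graph `G`. -/
def eigenvaluesLE (G : L2On dm u v → L2On dm u v → Prop) (x : ℝ) : Set ℝ :=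
  {ev | ev ≤ x ∧ ∃ f, f ≠ 0 ∧ G f (ev • f)}

/-- A complete system of normalized eigenfunctions for the finitely many eigenvalues at most `x`,
indexed by the eigenvalues. -/
structure IsEigensystem (dm : Measure ℝ) [IsLocallyFiniteMeasure dm] (u v x : ℝ)
    (V : Submodule ℝ FunctionPair) (S : Finset ℝ) (w : ℝ → FunctionPair) : Prop where
  le : ∀ i ∈ S, i ≤ x
  mem : ∀ i ∈ S, w i ∈ V
  massForm_eq : ∀ i ∈ S, ∀ j ∈ S, massForm dm u v (w i) (w j) = if i = j then 1 else 0
  energyForm_eq : ∀ i ∈ S, ∀ j ∈ S, energyForm u v (w i) (w j) = if i = j then i else 0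
  complete : ∀ z ∈ V, (∀ i ∈ S, massForm dm u v (w i) z = 0) → 0 < massForm dm u v z z →
    x * massForm dm u v z z < energyForm u v z z

theorem IsFormProblem.exists_normalized (P : IsFormProblem dm u v V G) {ev : ℝ}
    {f : L2On dm u v} (hf0 : f ≠ 0) (hf : G f (ev • f)) :
    ∃ w ∈ V, massForm dm u v w w = 1 ∧
      (∀ z ∈ V, energyForm u v w z = ev * massForm dm u v w z) ∧
      ∀ f', G f' (ev • f') → ∀ z : FunctionPair, massForm dm u v w z = 0 →
        ∫ y, f' y * z.1.1 y ∂(dm.restrict (Ioo u v)) = 0 := by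
  obtain ⟨w, hw, hfw, hweak⟩ := P.weak ev f hf
  have hn : ‖f‖ ≠ 0 := norm_ne_zero_iff.mpr hf0
  refine ⟨‖f‖⁻¹ • w, V.smul_mem _ hw, ?_, fun z hz => ?_, fun f' hf' z hz => ?_⟩
  · simp only [map_smul, LinearMap.smul_apply, smul_eq_mul, massForm_eq_norm_sq hfw]
    field_simp
  · simp only [map_smul, LinearMap.smul_apply, smul_eq_mul, hweak z hz]
    ring
  · simp only [map_smul, LinearMap.smul_apply, smul_eq_mul] at hz
    have hz' := (mul_eq_zero.mp hz).resolve_left (inv_ne_zero hn)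
    obtain ⟨a, rfl⟩ := P.simple ev f f' hf0 hf hf'
    have h1 : ∫ y, (a • f : L2On dm u v) y * z.1.1 y ∂(dm.restrict (Ioo u v)) =
        a * massForm dm u v w z := by
      rw [massForm_apply, ← integral_const_mul]
      refine integral_congr_ae ?_
      filter_upwards [Lp.coeFn_smul a f, hfw] with y h1 h2
      rw [h1, Pi.smul_apply, h2, smul_eq_mul, mul_assoc]
    rw [h1, hz', mul_zero]

/-- There are finitely many eigenvalues below any bound, and their normalized eigenfunctions form
a complete system. -/
theorem IsFormProblem.exists_eigensystem (huv : u < v) (hx : 0 ≤ x)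
    (P : IsFormProblem dm u v V G) :
    ∃ (S : Finset ℝ) (w : ℝ → FunctionPair), (S : Set ℝ) = eigenvaluesLE G x ∧
      IsEigensystem dm u v x V S w := by
  have hex : ∀ ev : ℝ, ∃ w : FunctionPair, ev ∈ eigenvaluesLE G x → w ∈ V ∧
      massForm dm u v w w = 1 ∧ (∀ z ∈ V, energyForm u v w z = ev * massForm dm u v w z) ∧
      ∀ f', G f' (ev • f') → ∀ z : FunctionPair, massForm dm u v w z = 0 →
        ∫ y, f' y * z.1.1 y ∂(dm.restrict (Ioo u v)) = 0 := by
    intro ev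
    by_cases hev : ev ∈ eigenvaluesLE G x
    · obtain ⟨-, f, hf0, hf⟩ := hev
      obtain ⟨w, h⟩ := P.exists_normalized hf0 hf
      exact ⟨w, fun _ => h⟩
    · exact ⟨0, fun h => absurd h hev⟩
  choose w hw using hex
  have hmass : ∀ i ∈ eigenvaluesLE G x, ∀ j ∈ eigenvaluesLE G x,
      massForm dm u v (w i) (w j) = if i = j then 1 else 0 := by
    intro i hi j hj
    split_ifs with hij
    · subst hij; exact (hw i hi).2.1
    · have h1 := (hw i hi).2.2.1 (w j) (hw j hj).1
      rw [energyForm_comm, (hw j hj).2.2.1 (w i) (hw i hi).1, massForm_comm (w j)] at h1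
      -- Symmetry of both forms makes eigenfunctions of distinct eigenvalues orthogonal.
      have h2 : (i - j) * massForm dm u v (w i) (w j) = 0 := by linarith
      exact (mul_eq_zero.mp h2).resolve_left (sub_ne_zero.mpr hij)
  have henergy : ∀ i ∈ eigenvaluesLE G x, ∀ j ∈ eigenvaluesLE G x,
      energyForm u v (w i) (w j) = if i = j then i else 0 := by
    intro i hi j hj
    rw [(hw i hi).2.2.1 (w j) (hw j hj).1, hmass i hi j hj]
    split_ifs <;> simp
  have hfin : (eigenvaluesLE G x).Finite := by
    by_contra hinf
    -- With `N + 2` eigenfunctions against `N + 1` grid points, some combination vanishes on the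
    -- grid. For this `N` the grid estimate makes its mass strictly smaller than itself.
    obtain ⟨N, hN⟩ := exists_nat_gt ((v - u) * (dm.restrict (Ioo u v)).real univ * x)
    have hμ : 0 ≤ (dm.restrict (Ioo u v)).real univ := measureReal_nonneg
    have hN0 : (0 : ℝ) < N :=
      lt_of_le_of_lt (mul_nonneg (mul_nonneg (sub_pos.mpr huv).le hμ) hx) hN
    obtain ⟨t, htA, htc⟩ := Set.Infinite.exists_subset_card_eq hinf (N + 2)
    obtain ⟨z, hz, hz0, hzpos, hzle⟩ := exists_mem_span_forall_eq_zero (massForm dm u v)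
      (energyForm u v) (fun i : t => w i) (fun i : t => (i : ℝ)) (x := x)
      (fun i => (htA i.2).1)
      (fun i j => (hmass i (htA i.2) j (htA j.2)).trans (if_congr Subtype.ext_iff.symm rfl rfl))
      (fun i j => (henergy i (htA i.2) j (htA j.2)).trans (if_congr Subtype.ext_iff.symm rfl rfl))
      (fun j : Fin (N + 1) => evalAt (u + j * ((v - u) / N))) (by simp [htc])
    have hzV : z ∈ neumannForms u v := P.le_neumannForms <|
      (Submodule.span_le.mpr (by rintro _ ⟨i, rfl⟩; exact (hw i (htA i.2)).1)) hz
    have h1 := massForm_le_of_grid (dm := dm) huv (by exact_mod_cast hN0) hzV hz0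
    have h2 : ((v - u) / N) * (dm.restrict (Ioo u v)).real univ * energyForm u v z z ≤
        ((v - u) / N) * (dm.restrict (Ioo u v)).real univ * (x * massForm dm u v z z) :=
      mul_le_mul_of_nonneg_left hzle
        (mul_nonneg (div_nonneg (sub_pos.mpr huv).le hN0.le) hμ)
    have h3 : ((v - u) / N) * (dm.restrict (Ioo u v)).real univ * (x * massForm dm u v z z) =
        ((v - u) * (dm.restrict (Ioo u v)).real univ * x / N) * massForm dm u v z z := by ring
    have h4 : (v - u) * (dm.restrict (Ioo u v)).real univ * x / N < 1 := by
      rwa [div_lt_one hN0]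
    nlinarith
  refine ⟨hfin.toFinset, w, hfin.coe_toFinset, ?_, ?_, ?_, ?_, ?_⟩
  · exact fun i hi => (hfin.mem_toFinset.mp hi).1
  · exact fun i hi => (hw i (hfin.mem_toFinset.mp hi)).1
  · exact fun i hi j hj => hmass i (hfin.mem_toFinset.mp hi) j (hfin.mem_toFinset.mp hj)
  · exact fun i hi j hj => henergy i (hfin.mem_toFinset.mp hi) j (hfin.mem_toFinset.mp hj)
  · intro z hz horth hpos
    refine P.variational x hx z hz (fun ev hev f hf => ?_) hpos
    -- The orthogonality required also covers `f = 0`, where `ev` need not be an eigenvalue.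
    by_cases hf0 : f = 0
    · subst hf0
      rw [← integral_zero ℝ ℝ (μ := dm.restrict (Ioo u v))]
      refine integral_congr_ae ?_
      filter_upwards [Lp.coeFn_zero ℝ 2 (dm.restrict (Ioo u v))] with y hy
      rw [hy]; simp
    · have hmem : ev ∈ eigenvaluesLE G x := ⟨hev, f, hf0, hf⟩
      exact (hw ev hmem).2.2.2 f hf z (horth ev (hfin.mem_toFinset.mpr hmem))

theorem exists_dirichlet_eigensystem (huv : u < v) (hx : 0 ≤ x) :
    ∃ (S : Finset ℝ) (w : ℝ → FunctionPair), dirichletCount dm u v x = S.card ∧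
      IsEigensystem dm u v x (dirichletForms u v) S w := by
  obtain ⟨S, w, hS, hw⟩ := (isFormProblem_dirichlet (dm := dm) huv).exists_eigensystem huv hx
  exact ⟨S, w, by rw [← Set.encard_coe_eq_coe_finsetCard, hS]; rfl, hw⟩

theorem exists_neumann_eigensystem (huv : u < v) (hx : 0 ≤ x) :
    ∃ (S : Finset ℝ) (w : ℝ → FunctionPair), neumannCount dm u v x = S.card ∧
      IsEigensystem dm u v x (neumannForms u v) S w := by
  obtain ⟨S, w, hS, hw⟩ := (isFormProblem_neumann (dm := dm) huv).exists_eigensystem huv hx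
  exact ⟨S, w, by rw [← Set.encard_coe_eq_coe_finsetCard, hS]; rfl, hw⟩

/-- If there are more eigenfunctions than linear constraints, some nonzero function in their span
satisfies the constraints and has Rayleigh quotient at most `x`. -/
theorem IsEigensystem.exists_mem_forall_eq_zero {S : Finset ℝ} {w : ℝ → FunctionPair}
    (hS : IsEigensystem dm u v x V S w) {κ : Type*} [Fintype κ] (ℓ : κ → FunctionPair →ₗ[ℝ] ℝ)
    (hcard : Fintype.card κ < S.card) :
    ∃ z ∈ V, (∀ k, ℓ k z = 0) ∧ 0 < massForm dm u v z z ∧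
      energyForm u v z z ≤ x * massForm dm u v z z := by
  obtain ⟨z, hz, h⟩ := exists_mem_span_forall_eq_zero (massForm dm u v)
      (energyForm u v) (fun i : S => w i) (fun i : S => (i : ℝ)) (x := x)
      (fun i => hS.le i i.2)
      (fun i j => (hS.massForm_eq i i.2 j j.2).trans (if_congr Subtype.ext_iff.symm rfl rfl))
      (fun i j => (hS.energyForm_eq i i.2 j j.2).trans (if_congr Subtype.ext_iff.symm rfl rfl))
      ℓ (by simpa using hcard)
  exact ⟨z, (Submodule.span_le.mpr (by rintro _ ⟨i, rfl⟩; exact hS.mem i i.2)) hz, h⟩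

theorem dirichletCount_le_neumannCount (huv : u < v) (hx : 0 ≤ x) :
    dirichletCount dm u v x ≤ neumannCount dm u v x := by
  obtain ⟨S, w, hSc, hS⟩ := exists_dirichlet_eigensystem (dm := dm) huv hx
  obtain ⟨T, w', hTc, hT⟩ := exists_neumann_eigensystem (dm := dm) huv hx
  rw [hSc, hTc, Nat.cast_le]
  by_contra! hlt
  obtain ⟨z, hz, hz0, hpos, hle⟩ := hS.exists_mem_forall_eq_zero
    (fun i : T => massForm dm u v (w' i)) (by simpa using hlt)
  exact (hT.complete z (dirichletForms_le_neumannForms u v hz) (fun i hi => hz0 ⟨i, hi⟩)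
    hpos).not_ge hle

theorem neumannCount_le_dirichletCount_add_two (huv : u < v) (hx : 0 ≤ x) :
    neumannCount dm u v x ≤ dirichletCount dm u v x + 2 := by
  obtain ⟨S, w, hSc, hS⟩ := exists_neumann_eigensystem (dm := dm) huv hx
  obtain ⟨T, w', hTc, hT⟩ := exists_dirichlet_eigensystem (dm := dm) huv hx
  rw [hSc, hTc]
  norm_cast
  by_contra! hlt
  obtain ⟨z, hz, hz0, hpos, hle⟩ := hS.exists_mem_forall_eq_zero
    -- The `2` in the bound: two further constraints put `z` in the Dirichlet form domain.
    (Sum.elim (fun i : T => massForm dm u v (w' i)) ![evalAt u, evalAt v]) (by simpa using hlt)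
  have hzD : z ∈ dirichletForms u v := ⟨hz, hz0 (Sum.inr 0), hz0 (Sum.inr 1)⟩
  exact (hT.complete z hzD (fun i hi => hz0 (Sum.inl ⟨i, hi⟩)) hpos).not_ge hle

theorem neumannCount_lt_top (huv : u < v) (hx : 0 ≤ x) : neumannCount dm u v x < ⊤ := by
  obtain ⟨S, w, hSc, hS⟩ := exists_neumann_eigensystem (dm := dm) huv hx
  rw [hSc]
  exact ENat.natCast_lt_top _

end Systems

/-! ### Passing between the interval and its pieces. -/

section Subdivision

open Set

variable {dm : Measure ℝ} [IsLocallyFiniteMeasure dm] {a b u v x : ℝ}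

theorem indicator_mem_boundedMeasurable {s : Set ℝ} (hs : MeasurableSet s) (f : BddBorel) :
    s.indicator f.1 ∈ boundedMeasurable := by
  obtain ⟨C, hC⟩ := f.2.2
  refine ⟨f.2.1.indicator hs, C, fun x => ?_⟩
  by_cases hx : x ∈ s
  · rw [indicator_of_mem hx]; exact hC x
  · rw [indicator_of_notMem hx, abs_zero]; exact (abs_nonneg _).trans (hC x)

/-- Extension of a function pair on `[u, v]` by zero. -/
noncomputable def zeroExtension (u v : ℝ) (w : FunctionPair) : FunctionPair :=
  (⟨_, indicator_mem_boundedMeasurable (measurableSet_Ioo (a := u) (b := v)) w.1⟩,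
    ⟨_, indicator_mem_boundedMeasurable (measurableSet_Ioc (a := u) (b := v)) w.2⟩)

/-- Vanishing at `u` and `v` is what keeps the extension a primitive: the integral of the extended
derivative is constantly zero beyond both endpoints. -/
theorem zeroExtension_mem_dirichletForms {w : FunctionPair} (hw : w ∈ dirichletForms u v)
    (hau : a ≤ u) (huv : u < v) (hvb : v ≤ b) : zeroExtension u v w ∈ dirichletForms a b := by
  have ha : (zeroExtension u v w).1.1 a = 0 :=
    indicator_of_notMem (fun h => h.1.not_ge hau) _
  have hb : (zeroExtension u v w).1.1 b = 0 :=
    indicator_of_notMem (fun h => h.2.not_ge hvb) _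
  refine ⟨fun x hx => ?_, ha, hb⟩
  have hint : ∫ y in a..x, (zeroExtension u v w).2.1 y = ∫ y in Ioc u (min x v), w.2.1 y := by
    rw [intervalIntegral.integral_of_le hx.1]
    change ∫ y in Ioc a x, (Ioc u v).indicator w.2.1 y = _
    rw [setIntegral_indicator measurableSet_Ioc, Ioc_inter_Ioc, sup_of_le_right hau]
  rw [ha, zero_add, hint]
  change (Ioo u v).indicator w.1.1 x = _
  rcases le_total x u with hxu | hux
  · rw [indicator_of_notMem fun h => h.1.not_ge hxu,
      Ioc_eq_empty (fun h => (h.trans_le (min_le_left x v)).not_ge hxu), setIntegral_empty]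
  · have hmin : min x v ∈ Icc u v := ⟨le_min hux huv.le, min_le_right _ _⟩
    have h1 := hw.1 _ hmin
    rw [hw.2.1, zero_add, intervalIntegral.integral_of_le hmin.1] at h1
    rw [← h1]
    by_cases hxI : x ∈ Ioo u v
    · rw [indicator_of_mem hxI, min_eq_left hxI.2.le]
    · rw [indicator_of_notMem hxI]
      rcases eq_or_lt_of_le hux with rfl | hlt
      · rw [min_eq_left huv.le, hw.2.1]
      · rw [min_eq_right (not_lt.mp fun h => hxI ⟨hlt, h⟩), hw.2.2]

theorem massForm_zeroExtension_left (hau : a ≤ u) (hvb : v ≤ b) (w z : FunctionPair) :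
    massForm dm a b (zeroExtension u v w) z = massForm dm u v w z := by
  have h (y : ℝ) : (zeroExtension u v w).1.1 y * z.1.1 y =
      (Ioo u v).indicator (fun y => w.1.1 y * z.1.1 y) y :=
    (indicator_mul_left (Ioo u v) w.1.1 z.1.1).symm
  simp_rw [massForm_apply, h]
  rw [setIntegral_indicator measurableSet_Ioo, inter_eq_right.mpr (Ioo_subset_Ioo hau hvb)]

theorem energyForm_zeroExtension_left (hau : a ≤ u) (hvb : v ≤ b) (w z : FunctionPair) :
    energyForm a b (zeroExtension u v w) z = energyForm u v w z := by
  have h (y : ℝ) : (zeroExtension u v w).2.1 y * z.2.1 y =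
      (Ioc u v).indicator (fun y => w.2.1 y * z.2.1 y) y :=
    (indicator_mul_left (Ioc u v) w.2.1 z.2.1).symm
  simp_rw [energyForm_apply, h]
  rw [setIntegral_indicator measurableSet_Ioc, inter_eq_right.mpr (Ioc_subset_Ioc hau hvb)]

theorem massForm_zeroExtension_right_of_disjoint {s t : ℝ} (h : Disjoint (Ioo u v) (Ioo s t))
    (w z : FunctionPair) : massForm dm u v w (zeroExtension s t z) = 0 := by
  rw [massForm_apply]
  refine integral_eq_zero_of_ae ?_
  filter_upwards [ae_restrict_mem measurableSet_Ioo] with y hy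
  exact mul_eq_zero_of_right _ (indicator_of_notMem (h.notMem_of_mem_left hy) _)

theorem energyForm_zeroExtension_right_of_disjoint {s t : ℝ} (h : Disjoint (Ioc u v) (Ioc s t))
    (w z : FunctionPair) : energyForm u v w (zeroExtension s t z) = 0 := by
  rw [energyForm_apply]
  refine integral_eq_zero_of_ae ?_
  filter_upwards [ae_restrict_mem measurableSet_Ioc] with y hy
  exact mul_eq_zero_of_right _ (indicator_of_notMem (h.notMem_of_mem_left hy) _)

theorem neumannForms_subinterval {w : FunctionPair} (hw : w ∈ neumannForms a b)
    (hau : a ≤ u) (hvb : v ≤ b) : w ∈ neumannForms u v := by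
  intro x hx
  rw [hw x ⟨hau.trans hx.1, hx.2.trans hvb⟩, hw u ⟨hau, (hx.1.trans hx.2).trans hvb⟩,
    ← intervalIntegral.integral_add_adjacent_intervals (w.2.intervalIntegrable a u)
      (w.2.intervalIntegrable u x), add_assoc]

variable {n : ℕ} {p : Fin (n + 1) → ℝ}

theorem sum_intervalIntegral_fin {μ : Measure ℝ} {f : ℝ → ℝ}
    (hf : ∀ s t, IntervalIntegrable f μ s t) (n : ℕ) (p : Fin (n + 1) → ℝ) :
    ∑ i : Fin n, ∫ y in (p i.castSucc)..(p i.succ), f y ∂μ =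
      ∫ y in (p 0)..(p (Fin.last n)), f y ∂μ := by
  induction n with
  | zero => simp
  | succ n ih =>
    rw [Fin.sum_univ_castSucc, ← intervalIntegral.integral_add_adjacent_intervals
      (hf (p 0) (p (Fin.last n).castSucc)) (hf _ _), ← Fin.succ_last]
    congr 1
    exact ih (p ∘ Fin.castSucc)

theorem energyForm_eq_sum (hp : Monotone p) (w : FunctionPair) :
    energyForm (p 0) (p (Fin.last n)) w w =
      ∑ i : Fin n, energyForm (p i.castSucc) (p i.succ) w w := by
  simp_rw [energyForm_apply]
  rw [← intervalIntegral.integral_of_le (hp (Fin.zero_le _)), ← sum_intervalIntegral_fin]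
  · refine Finset.sum_congr rfl fun i _ => ?_
    rw [intervalIntegral.integral_of_le (hp (Fin.castSucc_lt_succ).le)]
  · exact fun s t => ⟨w.2.integrable_mul w.2 (volume.restrict (Ioc s t)),
      w.2.integrable_mul w.2 (volume.restrict (Ioc t s))⟩

/-- The mass forms integrate over open intervals, so the pieces miss the interior partition points;
these carry no mass because `dm` has no atoms there. -/
theorem massForm_eq_sum (hp : Monotone p) (hdm : ∀ r, dm {p r} = 0) (w : FunctionPair) :
    massForm dm (p 0) (p (Fin.last n)) w w =
      ∑ i : Fin n, massForm dm (p i.castSucc) (p i.succ) w w := by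
  have key {r s : Fin (n + 1)} (hrs : r ≤ s) :
      massForm dm (p r) (p s) w w = ∫ y in (p r)..(p s), w.1.1 y * w.1.1 y ∂dm := by
    rw [massForm_apply, intervalIntegral.integral_of_le (hp hrs),
      Measure.restrict_congr_set (Ioo_ae_eq_Ioc' (hdm s))]
  have hfin (s t : ℝ) : IsFiniteMeasure (dm.restrict (Ioc s t)) :=
    ⟨by simpa using measure_Ioc_lt_top⟩
  have hint (s t : ℝ) : IntervalIntegrable (fun y => w.1.1 y * w.1.1 y) dm s t :=
    ⟨w.1.integrable_mul w.1 (dm.restrict (Ioc s t)),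
      w.1.integrable_mul w.1 (dm.restrict (Ioc t s))⟩
  rw [key (Fin.zero_le _), ← sum_intervalIntegral_fin hint]
  exact Finset.sum_congr rfl fun i _ => (key (Fin.castSucc_lt_succ).le).symm

/-- Zero extensions from different pieces have disjoint supports, so together the eigenfunctions of
all pieces are orthonormal for the mass and diagonal for the energy on the whole interval. -/
theorem sum_dirichletCount_le (hn : p 0 < p (Fin.last n)) (hp : StrictMono p) (hx : 0 ≤ x) :
    ∑ i : Fin n, dirichletCount dm (p i.castSucc) (p i.succ) x ≤
      dirichletCount dm (p 0) (p (Fin.last n)) x := by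
  have hl (i : Fin n) : p 0 ≤ p i.castSucc := hp.monotone (Fin.zero_le _)
  have hr (i : Fin n) : p i.succ ≤ p (Fin.last n) := hp.monotone (Fin.le_last _)
  have hlt (i : Fin n) : p i.castSucc < p i.succ := hp Fin.castSucc_lt_succ
  choose S w hSc hS using fun i : Fin n => exists_dirichlet_eigensystem (dm := dm) (hlt i) hx
  obtain ⟨T, w', hTc, hT⟩ := exists_dirichlet_eigensystem (dm := dm) hn hx
  simp_rw [hTc, hSc]
  norm_cast
  by_contra! hcard
  have hsep {i j : Fin n} (hij : i ≠ j) :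
      p i.succ ≤ p j.castSucc ∨ p j.succ ≤ p i.castSucc := by
    rcases lt_or_gt_of_ne hij with h | h
    · exact Or.inl (hp.monotone (Fin.succ_le_castSucc_iff.mpr h))
    · exact Or.inr (hp.monotone (Fin.succ_le_castSucc_iff.mpr h))
  let W (i : Σ i : Fin n, S i) : FunctionPair :=
    zeroExtension (p i.1.castSucc) (p i.1.succ) (w i.1 i.2)
  have hmass (i j : Σ i : Fin n, S i) :
      massForm dm (p 0) (p (Fin.last n)) (W i) (W j) = if i = j then 1 else 0 := by
    obtain ⟨i, s⟩ := i
    obtain ⟨j, t⟩ := j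
    rw [massForm_zeroExtension_left (hl i) (hr i)]
    by_cases hij : i = j
    · subst hij
      rw [massForm_comm, massForm_zeroExtension_left le_rfl le_rfl, massForm_comm,
        (hS i).massForm_eq _ s.2 _ t.2]
      exact if_congr (by simp) rfl rfl
    · rw [massForm_zeroExtension_right_of_disjoint, if_neg (fun h => hij (congrArg Sigma.fst h))]
      refine disjoint_left.mpr fun y hy hy' => ?_
      rcases hsep hij with h | h
      · exact (hy.2.trans_le h).not_gt hy'.1
      · exact (hy'.2.trans_le h).not_gt hy.1
  have henergy (i j : Σ i : Fin n, S i) :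
      energyForm (p 0) (p (Fin.last n)) (W i) (W j) = if i = j then (i.2 : ℝ) else 0 := by
    obtain ⟨i, s⟩ := i
    obtain ⟨j, t⟩ := j
    rw [energyForm_zeroExtension_left (hl i) (hr i)]
    by_cases hij : i = j
    · subst hij
      rw [energyForm_comm, energyForm_zeroExtension_left le_rfl le_rfl, energyForm_comm,
        (hS i).energyForm_eq _ s.2 _ t.2]
      exact if_congr (by simp) rfl rfl
    · rw [energyForm_zeroExtension_right_of_disjoint, if_neg (fun h => hij (congrArg Sigma.fst h))]
      refine disjoint_left.mpr fun y hy hy' => ?_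
      rcases hsep hij with h | h
      · exact (hy.2.trans h).not_gt hy'.1
      · exact (hy'.2.trans h).not_gt hy.1
  obtain ⟨z, hz, hz0, hpos, hle⟩ := exists_mem_span_forall_eq_zero
    (massForm dm (p 0) (p (Fin.last n))) (energyForm (p 0) (p (Fin.last n))) W
    (fun i => (i.2 : ℝ)) (x := x) (fun i => (hS i.1).le _ i.2.2) hmass henergy
    (fun i : T => massForm dm (p 0) (p (Fin.last n)) (w' i)) (by simpa using hcard)
  have hzV : z ∈ dirichletForms (p 0) (p (Fin.last n)) := by
    refine (Submodule.span_le.mpr ?_) hz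
    rintro _ ⟨i, rfl⟩
    exact zeroExtension_mem_dirichletForms ((hS i.1).mem _ i.2.2) (hl _) (hlt _) (hr _)
  exact (hT.complete z hzV (fun i hi => hz0 ⟨i, hi⟩) hpos).not_ge hle

/-- The constraints are orthogonality, piece by piece, to the eigenfunctions of every piece;
completeness on each piece then adds up because both forms are additive. -/
theorem neumannCount_le_sum (hn : p 0 < p (Fin.last n)) (hp : StrictMono p)
    (hdm : ∀ r, dm {p r} = 0) (hx : 0 ≤ x) :
    neumannCount dm (p 0) (p (Fin.last n)) x ≤
      ∑ i : Fin n, neumannCount dm (p i.castSucc) (p i.succ) x := by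
  have hlt (i : Fin n) : p i.castSucc < p i.succ := hp Fin.castSucc_lt_succ
  choose S w hSc hS using fun i : Fin n => exists_neumann_eigensystem (dm := dm) (hlt i) hx
  obtain ⟨T, w', hTc, hT⟩ := exists_neumann_eigensystem (dm := dm) hn hx
  simp_rw [hTc, hSc]
  norm_cast
  by_contra! hcard
  obtain ⟨z, hz, hz0, hpos, hle⟩ := hT.exists_mem_forall_eq_zero
    (fun i : Σ i : Fin n, S i => massForm dm (p i.1.castSucc) (p i.1.succ) (w i.1 i.2))
    (by simpa using hcard)
  rw [massForm_eq_sum hp.monotone hdm] at hpos hle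
  rw [energyForm_eq_sum hp.monotone, Finset.mul_sum] at hle
  have hstrict (i : Fin n) (hi : 0 < massForm dm (p i.castSucc) (p i.succ) z z) :
      x * massForm dm (p i.castSucc) (p i.succ) z z <
        energyForm (p i.castSucc) (p i.succ) z z :=
    (hS i).complete z (neumannForms_subinterval hz (hp.monotone (Fin.zero_le _))
      (hp.monotone (Fin.le_last _))) (fun j hj => hz0 ⟨i, j, hj⟩) hi
  obtain ⟨i, -, hi⟩ := Finset.exists_lt_of_sum_lt (by simpa using hpos :
    ∑ _i : Fin n, (0 : ℝ) < ∑ i : Fin n, massForm dm (p i.castSucc) (p i.succ) z z)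
  refine hle.not_gt (Finset.sum_lt_sum (fun j _ => ?_) ⟨i, Finset.mem_univ i, hstrict i hi⟩)
  -- Completeness speaks only of positive mass; on a piece of zero mass it is enough that the energy
  -- is nonnegative.
  rcases (massForm_self_nonneg (dm := dm) (u := p j.castSucc) (v := p j.succ) z).eq_or_lt with h | h
  · rw [← h, mul_zero]; exact energyForm_self_nonneg z
  · exact (hstrict j h).le

instance isLocallyFiniteMeasure_stieltjesMeasureOn (hab : a ≤ b) (m : Icc a b → ℝ)
    (hm : Monotone m) : IsLocallyFiniteMeasure (stieltjesMeasureOn hab m hm) :=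
  inferInstanceAs (IsLocallyFiniteMeasure (hm.IccExtend hab).stieltjesFunction.measure)

theorem stieltjesMeasureOn_singleton_eq_zero {hab : a ≤ b} {m : Icc a b → ℝ} (hm : Monotone m)
    {y : ℝ} (hy : jumpAt (IccExtend hab m) y = 0) : stieltjesMeasureOn hab m hm {y} = 0 := by
  have hM := hm.IccExtend hab
  rw [stieltjesMeasureOn, StieltjesFunction.measure_singleton, ENNReal.ofReal_eq_zero,
    Monotone.stieltjesFunction_eq]
  -- The atom is computed from the right-continuous version, so its left limit must be bounded below
  -- by that of the original function.
  have h1 : Function.leftLim (IccExtend hab m) y ≤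
      Function.leftLim hM.stieltjesFunction y := by
    refine le_of_tendsto (hM.tendsto_leftLim y) ?_
    filter_upwards [self_mem_nhdsWithin] with z hz
    exact (hM.le_rightLim le_rfl).trans (hM.stieltjesFunction.mono.le_leftLim hz)
  rw [jumpAt] at hy
  linarith

end Subdivision

/-! ### The bracketing theorem. -/

theorem theorem7p1 (a b : ℝ) (hab : a < b) (n : ℕ) (p : Fin (n + 1) → ℝ)
    (hp : StrictMono p) (hpa : p 0 = a) (hpb : p (Fin.last n) = b)
    (m : Set.Icc a b → ℝ) (hm : Monotone m)
    (hjump : ∀ r : Fin (n + 1), jumpAt (Set.IccExtend hab.le m) (p r) = 0)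
    (hright : ∀ r : Fin n, ∀ ε : ℝ, 0 < ε →
      0 < stieltjesMeasureOn hab.le m hm (Set.Icc (p r.castSucc) (p r.castSucc + ε)))
    (hleft : ∀ r : Fin n, ∀ ε : ℝ, 0 < ε →
      0 < stieltjesMeasureOn hab.le m hm (Set.Icc (p r.succ - ε) (p r.succ)))
    (x : ℝ) (hx : 0 ≤ x) :
    neumannCount (stieltjesMeasureOn hab.le m hm) a b x < ⊤ ∧
    dirichletCount (stieltjesMeasureOn hab.le m hm) a b x ≤
      neumannCount (stieltjesMeasureOn hab.le m hm) a b x ∧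
    neumannCount (stieltjesMeasureOn hab.le m hm) a b x ≤
      dirichletCount (stieltjesMeasureOn hab.le m hm) a b x + 2 ∧
    ∑ i : Fin n, dirichletCount (stieltjesMeasureOn hab.le m hm) (p i.castSucc) (p i.succ) x ≤
      dirichletCount (stieltjesMeasureOn hab.le m hm) a b x ∧
    neumannCount (stieltjesMeasureOn hab.le m hm) a b x ≤
      ∑ i : Fin n, neumannCount (stieltjesMeasureOn hab.le m hm) (p i.castSucc) (p i.succ) x ∧
    dirichletCount (stieltjesMeasureOn hab.le m hm) a b x ≤
      2 * (n : ℕ∞) +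
        ∑ i : Fin n, dirichletCount (stieltjesMeasureOn hab.le m hm) (p i.castSucc) (p i.succ) x := by
  have hatom (r : Fin (n + 1)) : stieltjesMeasureOn hab.le m hm {p r} = 0 :=
    stieltjesMeasureOn_singleton_eq_zero hm (hjump r)
  have hlt (i : Fin n) : p i.castSucc < p i.succ := hp Fin.castSucc_lt_succ
  subst hpa hpb
  have hDN := dirichletCount_le_neumannCount (dm := stieltjesMeasureOn hab.le m hm) hab hx
  have hsum := neumannCount_le_sum hab hp hatom hx
  refine ⟨neumannCount_lt_top hab hx, hDN, neumannCount_le_dirichletCount_add_two hab hx,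
    sum_dirichletCount_le hab hp hx, hsum, hDN.trans (hsum.trans ?_)⟩
  -- Each piece loses at most `2` in passing from Neumann to Dirichlet, which gives `2 * n`.
  calc _ ≤ ∑ i : Fin n,
        (dirichletCount (stieltjesMeasureOn hab.le m hm) (p i.castSucc) (p i.succ) x + 2) :=
        Finset.sum_le_sum fun i _ => neumannCount_le_dirichletCount_add_two (hlt i) hx
    _ = _ := by
        rw [Finset.sum_add_distrib, Finset.sum_const, Finset.card_univ, Fintype.card_fin,
          nsmul_eq_mul, add_comm, mul_comm]
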